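/- Throughout, powers and $\operatorname{Arg}\in(-\pi,\pi]$ are principal. Let $0\le m\le q$, $0\le n\le p$ be integers, $a_1,\dots,a_p,b_1,\dots,b_q\in\mathbb C$, and let $r\in\mathbb R\setminus\{0\}$. The generalized Meijer $G$-function is $$G^{m,n}_{p,q}\!\left(x,r\,\middle|\,{a_1,\dots,a_p\atop b_1,\dots,b_q}\right)=\frac1{2\pi i}\int_{\gamma-i\infty}^{\gamma+i\infty}\frac{\prod_{k=1}^m\Gamma(b_k+s)\prod_{k=1}^n\Gamma(1-a_k-s)}{\prod_{k=n+1}^p\Gamma(a_k+s)\prod_{k=m+1}^q\Gamma(1-b_k-s)}\,x^{-s/r}\,ds ,$$ the integral being taken along any vertical line on which it converges absolutely and which has the poles of $\Gamma(b_k+s)$ $(k\le m)$ on its left and those of $\Gamma(1-a_k-s)$ $(k\le n)$ on its right; $G^{m,n}_{p,q}(x|\cdot)$ is the case $r=1$. The Fox function $H^{m,n}_{p,q}\bigl[x\,\big|\,{(a_k,A_k)\atop(b_k,B_k)}\bigr]$, $A_k,B_k>0$, is defined in the same way, with $\Gamma(b_k+B_ks)$, $\Gamma(1-a_k-A_ks)$,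 $\Gamma(a_k+A_ks)$, $\Gamma(1-b_k-B_ks)$ and $x^{-s}$ in place of $\Gamma(b_k+s)$, $\Gamma(1-a_k-s)$, $\Gamma(a_k+s)$, $\Gamma(1-b_k-s)$ and $x^{-s/r}$. Put $$c=m+n-\tfrac{p+q}2,\qquad \mu=\sum_{k=1}^q b_k-\sum_{k=1}^p a_k+\tfrac{p-q}2+1 .$$ Let $\alpha,\beta,w,z\in\mathbb C$ with $w\ne0$, $z\neq 0$, $\operatorname{Re}\beta>0$, and let $g\in\mathbb R$ with $g/r>0$. Suppose that there is a real $\gamma$ with $-\operatorname{Re}b_k<\gamma$ for $1\le k\le m$, $\gamma<1-\operatorname{Re}a_k$ for $1\le k\le n$ and $\frac gr\gamma<\operatorname{Re}\alpha$, such that either * $c>0$ and $|\operatorname{Arg}(wz^g)|<|r|\,c\,\pi$, or * $c=0$, $wz^g>0$ and $(q-p)\gamma+\operatorname{Re}\mu<0$. Then $G^{m,n}_{p,q}(w\tau^g,r|a;b)$ is defined for all $\tau\neq0$ on the segment $[0,z]$, and the Riemann–Liouville integral $$I=\frac1{\Gamma(\beta)}\int_0^z(z-\tau)^{\beta-1}\tau^{\alpha-1}\,G^{m,n}_{p,q}\!\left(w\tau^g,r\,\middle|\,{a_1,\dots,a_p\atop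 b_1,\dots,b_q}\right)d\tau$$ along this segment converges absolutely. Moreover: 1. If $\operatorname{Arg}(wz^g)=r\operatorname{Arg}\bigl(w^{1/r}z^{g/r}\bigr)$ (which holds, for example, if $z>0$ and $-\pi<\operatorname{Arg}(w)/r\le\pi$), then the following $H$-function is defined and $$I=z^{\alpha+\beta-1}\,H^{m,n+1}_{p+1,q+1}\!\left[w^{1/r}z^{g/r}\,\middle|\,{(1-\alpha,\frac gr),(a_1,1),\dots,(a_p,1)\atop(b_1,1),\dots,(b_q,1),(1-\alpha-\beta,\frac gr)}\right].$$ 2. If $g$ and $r$ are positive integers, then the following $G$-function is defined and $$I=z^{\alpha+\beta-1}\,\frac{r^{\mu}}{(2\pi)^{(r-1)c}\,g^{\beta}}\;G^{rm,\,rn+g}_{rp+g,\,rq+g}\!\left(\frac{wz^g}{r^{r(q-p)}}\,\middle|\,{\Delta_1,\Delta_2\atop\Delta_3,\Delta_4}\right),$$ where, with $D_k(x)=\frac xk,\frac{x+1}k,\dots,\frac{x+k-1}k$, $$\Delta_1=D_g(1-\alpha),D_r(a_1),\dots,D_r(a_n),\qquad \Delta_2=D_r(a_{n+1}),\dots,D_r(a_p),$$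 $$\Delta_3=D_r(b_1),\dots,D_r(b_m),\qquad \Delta_4=D_r(b_{m+1}),\dots,D_r(b_q),D_g(1-\alpha-\beta).$$ -/

import Mathlib

open Complex MeasureTheory

noncomputable section

/-- `(1 / (2πi)) ∫ F(s) ds` over the upward vertical line `Re s = γ`. -/
def lineIntegral (F : ℂ → ℂ) (γ : ℝ) : ℂ :=
  1 / (2 * (Real.pi : ℂ) * I) * ∫ y : ℝ, F ((γ : ℂ) + (y : ℂ) * I) * I

/-- The gamma quotient of the Meijer G-function `G^{m,n}_{p,q}`. The parameters are given in four
lists, `a₁ = a_1,…,a_n`, `a₂ = a_{n+1},…,a_p`, `b₁ = b_1,…,b_m`, `b₂ = b_{m+1},…,b_q`, so that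
`m, n, p, q` are read off from their lengths. -/
def meijerKernel (a₁ a₂ b₁ b₂ : List ℂ) (s : ℂ) : ℂ :=
  ((b₁.map fun b => Gamma (b + s)).prod * (a₁.map fun a => Gamma (1 - a - s)).prod) /
    ((a₂.map fun a => Gamma (a + s)).prod * (b₂.map fun b => Gamma (1 - b - s)).prod)

/-- The Mellin–Barnes integrand of `G^{m,n}_{p,q}(z, r | a; b)`, with the principal power. -/
def meijerIntegrand (a₁ a₂ b₁ b₂ : List ℂ) (z : ℂ) (r : ℝ) (s : ℂ) : ℂ :=
  meijerKernel a₁ a₂ b₁ b₂ s * z ^ (-s / (r : ℂ))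

/-- The line `Re s = γ` is a contour for `G^{m,n}_{p,q}(z, r | a; b)`: the poles of the
`Γ(b_k + s)`, `k ≤ m`, are to its left, those of the `Γ(1 - a_k - s)`, `k ≤ n`, are to its right,
and the Mellin–Barnes integral converges absolutely along it. -/
structure IsMeijerContour (a₁ a₂ b₁ b₂ : List ℂ) (z : ℂ) (r γ : ℝ) : Prop where
  left : ∀ b ∈ b₁, 0 < b.re + γ
  right : ∀ a ∈ a₁, 0 < 1 - a.re - γ
  integrable : VerticalIntegrable (meijerIntegrand a₁ a₂ b₁ b₂ z r) γ

open Classical in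
/-- The generalized Meijer G-function `G^{m,n}_{p,q}(z, r | a; b)`: the Mellin–Barnes integral along
a vertical contour (with value `0` if there is none). -/
def meijerGr (a₁ a₂ b₁ b₂ : List ℂ) (z : ℂ) (r : ℝ) : ℂ :=
  if h : ∃ γ : ℝ, IsMeijerContour a₁ a₂ b₁ b₂ z r γ then
    lineIntegral (meijerIntegrand a₁ a₂ b₁ b₂ z r) h.choose
  else 0

/-- The classical Meijer G-function `G^{m,n}_{p,q}(z | a; b)`. -/
def meijerG (a₁ a₂ b₁ b₂ : List ℂ) (z : ℂ) : ℂ :=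
  meijerGr a₁ a₂ b₁ b₂ z 1

/-- The gamma quotient of the Fox H-function `H^{m,n}_{p,q}`; the parameters are the pairs
`(a_k, A_k)` and `(b_k, B_k)`, split into four lists as for the Meijer G-function. -/
def foxKernel (a₁ a₂ b₁ b₂ : List (ℂ × ℝ)) (s : ℂ) : ℂ :=
  ((b₁.map fun b => Gamma (b.1 + b.2 * s)).prod * (a₁.map fun a => Gamma (1 - a.1 - a.2 * s)).prod) /
    ((a₂.map fun a => Gamma (a.1 + a.2 * s)).prod * (b₂.map fun b => Gamma (1 - b.1 - b.2 * s)).prod)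

/-- The Mellin–Barnes integrand of the Fox H-function. -/
def foxIntegrand (a₁ a₂ b₁ b₂ : List (ℂ × ℝ)) (z : ℂ) (s : ℂ) : ℂ :=
  foxKernel a₁ a₂ b₁ b₂ s * z ^ (-s)

/-- The line `Re s = γ` is a contour for the Fox H-function: the coefficients `A_k`, `B_k` are
positive, the line separates the poles of the two products in the numerator, and the Mellin–Barnes
integral converges absolutely along it. -/
structure IsFoxContour (a₁ a₂ b₁ b₂ : List (ℂ × ℝ)) (z : ℂ) (γ : ℝ) : Prop where
  pos : ∀ c ∈ a₁ ++ a₂ ++ b₁ ++ b₂, 0 < c.2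
  left : ∀ b ∈ b₁, 0 < b.1.re + b.2 * γ
  right : ∀ a ∈ a₁, 0 < 1 - a.1.re - a.2 * γ
  integrable : VerticalIntegrable (foxIntegrand a₁ a₂ b₁ b₂ z) γ

open Classical in
/-- The Fox H-function `H^{m,n}_{p,q}[z | (a, A); (b, B)]`: the Mellin–Barnes integral along a
vertical contour (with value `0` if there is none). -/
def foxH (a₁ a₂ b₁ b₂ : List (ℂ × ℝ)) (z : ℂ) : ℂ :=
  if h : ∃ γ : ℝ, IsFoxContour a₁ a₂ b₁ b₂ z γ then
    lineIntegral (foxIntegrand a₁ a₂ b₁ b₂ z) h.choose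
  else 0

/-- `m + n - (p + q) / 2`. -/
def meijerC (a₁ a₂ b₁ b₂ : List ℂ) : ℝ :=
  ((b₁.length : ℝ) + a₁.length) - (((a₁ ++ a₂).length : ℝ) + (b₁ ++ b₂).length) / 2

/-- `μ = ∑ b_k - ∑ a_k + (p - q) / 2 + 1`. -/
def meijerMu (a₁ a₂ b₁ b₂ : List ℂ) : ℂ :=
  (b₁ ++ b₂).sum - (a₁ ++ a₂).sum + (((a₁ ++ a₂).length : ℂ) - (b₁ ++ b₂).length) / 2 + 1

/-- The explicit conditions of convergence of the Mellin–Barnes integral of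
`G^{m,n}_{p,q}(z, r | a; b)` along `Re s = γ`: either `m + n - (p + q) / 2 > 0` and
`|arg z| < |r| (m + n - (p + q) / 2) π`, or `m + n = (p + q) / 2`, `z` is positive and
`(q - p) γ + Re μ < 0`. -/
def MeijerConvergence (a₁ a₂ b₁ b₂ : List ℂ) (z : ℂ) (r γ : ℝ) : Prop :=
  (0 < meijerC a₁ a₂ b₁ b₂ ∧ |z.arg| < |r| * meijerC a₁ a₂ b₁ b₂ * Real.pi) ∨
    (meijerC a₁ a₂ b₁ b₂ = 0 ∧ z.arg = 0 ∧
      (((b₁ ++ b₂).length : ℝ) - (a₁ ++ a₂).length) * γ + (meijerMu a₁ a₂ b₁ b₂).re < 0)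

/-- The integrand of the Riemann–Liouville integral of order `β` of `f` from `0` to the complex
point `z`, with the segment parametrized as `τ = t z`, `0 ≤ t ≤ 1`, `dτ = z dt`. -/
def rlIntegrand (β : ℂ) (f : ℂ → ℂ) (z : ℂ) (t : ℝ) : ℂ :=
  (z - t * z) ^ (β - 1) * f (t * z) * z

/-- The Riemann–Liouville integral `(1 / Γ(β)) ∫_0^z (z - τ)^(β - 1) f(τ) dτ`. -/
def rlIntegral (β : ℂ) (f : ℂ → ℂ) (z : ℂ) : ℂ :=
  1 / Gamma β * ∫ t in (0 : ℝ)..1, rlIntegrand β f z t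

/-- The list `c / k, (c + 1) / k, …, (c + k - 1) / k`. -/
def gaussList (k : ℕ) (c : ℂ) : List ℂ :=
  (List.range k).map fun j => (c + j) / k

/-- The pairs `(c, 1)` for `c` in the list. -/
def withOne (l : List ℂ) : List (ℂ × ℝ) :=
  l.map fun c => (c, 1)

end

/-! Write τ = tz with 0 < t ≤ 1, insert the Mellin–Barnes integral of the G-function and exchange
the integrations. As t is positive, all principal powers split, and with κ = g/r the inner integral
is the Beta integral of t^(α-κs-1) (1-t)^(β-1), equal to Γ(β) Γ(α-κs) / Γ(α+β-κs). Hence I is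
z^(α+β-1) times the original Mellin–Barnes integral with one more gamma quotient:
`rlIntegral_meijerGr_eq_lineIntegral`. On the line Re s = γ the double integrand is f(t) F(y) up to
a unimodular factor, so Fubini asks only for f and F to be integrable, and it also gives the
absolute convergence of the new line integral.

Reading the new quotient as one upper and one lower Fox parameter yields the H-form. For the G-form,
replace s by rs and break up every gamma factor by the multiplication formula of Gauss,
`Complex.prod_Gamma_add_div`, which follows from the Bohr–Mollerup theorem and analytic
continuation.

Two facts about the contours support this. The stated conditions imply absolute convergence, by the
Stirling growth of Γ on vertical lines (`isTheta_Gamma_vertical`,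
`MeijerConvergence.isMeijerContour`). The value is the same on every admissible line, which matters
because `meijerGr` and `foxH` pick an arbitrary one; this is Cauchy's theorem after multiplication
by a Gaussian factor exp(εs²) (`integral_vertical_eq`). -/

/-! ### Gauss's multiplication formula for the Gamma function. -/

section GaussMultiplication

open Finset

/-- The product of the `1 - ζ ^ k`, `1 ≤ k ≤ n`, for a primitive root of unity `ζ` of order
`n + 1`. -/
lemma IsPrimitiveRoot.prod_one_sub_pow_succ {K : Type*} [Field K] {ζ : K} {n : ℕ}
    (h : IsPrimitiveRoot ζ (n + 1)) :
    ∏ k ∈ range n, (1 - ζ ^ (k + 1)) = (n + 1 : K) := by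
  open Polynomial in
  have h1 : (∏ k ∈ range (n + 1), (X - C (ζ ^ k)) : K[X]) = X ^ (n + 1) - 1 := by
    have h2 := IsPrimitiveRoot.nthRoots_eq h (α := 1) (a := 1) (by simp)
    have h3 := X_pow_sub_one_eq_prod (Nat.succ_pos n) h
    classical
    rw [h3, nthRootsFinset, ← Multiset.toFinset_eq (IsPrimitiveRoot.nthRoots_one_nodup h)]
    simp only [Finset.prod]
    rw [h2, Multiset.map_map]
    simp
  open Polynomial in
  -- Cancelling X - 1 from the factorization of X^(n+1) - 1 leaves the geometric sum, whose value at
  -- 1 is n + 1.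
  have h4 : (∏ k ∈ range n, (X - C (ζ ^ (k + 1))) : K[X]) = ∑ i ∈ range (n + 1), X ^ i := by
    have h5 : (X - 1 : K[X]) ≠ 0 := X_sub_C_ne_zero 1
    apply mul_right_cancel₀ h5
    rw [geom_sum_mul, ← h1, prod_range_succ']
    simp
  have h6 := congrArg (Polynomial.eval 1) h4
  simpa [Polynomial.eval_prod, Polynomial.eval_finsetSum] using h6

/-- Each factor is |1 - ζ^(k+1)| for ζ = exp(2πi/(n+1)), so the product is the modulus of the
preceding identity. -/
lemma prod_two_mul_sin_pi_div (n : ℕ) :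
    ∏ k ∈ range n, (2 * Real.sin (Real.pi * ((k + 1) / (n + 1)))) = n + 1 := by
  have h := (Complex.isPrimitiveRoot_exp (n + 1) (Nat.succ_ne_zero n)).prod_one_sub_pow_succ
  have h1 := congrArg norm h
  rw [norm_prod] at h1
  rw [show ‖(n : ℂ) + 1‖ = n + 1 by
    rw [show (n : ℂ) + 1 = ((n + 1 : ℕ) : ℂ) by push_cast; rfl, norm_natCast]; push_cast; rfl] at h1
  refine Eq.trans (prod_congr rfl fun k hk => ?_) h1
  have hk' : (k : ℝ) + 1 ≤ n := by exact_mod_cast Finset.mem_range.mp hk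
  have hn : (0 : ℝ) < n + 1 := by positivity
  rw [norm_sub_rev, ← Complex.exp_nat_mul,
    show ((k + 1 : ℕ) : ℂ) * (2 * Real.pi * I / ((n + 1 : ℕ) : ℂ)) =
      I * ((2 * (Real.pi * ((k + 1) / (n + 1))) : ℝ) : ℂ) by push_cast; ring,
    Complex.norm_exp_I_mul_ofReal_sub_one, mul_div_cancel_left₀ _ (two_ne_zero' ℝ), Real.norm_of_nonneg]
  refine mul_nonneg zero_le_two (Real.sin_nonneg_of_nonneg_of_le_pi (by positivity) ?_)
  have : ((k : ℝ) + 1) / (n + 1) ≤ 1 := by rw [div_le_one hn]; linarith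
  nlinarith [Real.pi_pos]

/-- Reversing the order of the factors turns x into 1 - x; the square of the product is then
evaluated by the reflection formula and the sine product. This supplies the normalization at s = 1
in the Bohr–Mollerup argument. -/
lemma prod_Gamma_succ_div (n : ℕ) :
    ∏ k ∈ range n, Real.Gamma ((k + 1) / (n + 1)) =
      (2 * Real.pi) ^ ((n : ℝ) / 2) * (n + 1 : ℝ) ^ (-1 / 2 : ℝ) := by
  have hn : (0 : ℝ) < n + 1 := by positivity
  have hpos : ∀ k ∈ range n, 0 < Real.Gamma (((k : ℝ) + 1) / (n + 1)) := fun k _ =>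
    Real.Gamma_pos_of_pos (by positivity)
  have hrefl : ∏ k ∈ range n, Real.Gamma (((k : ℝ) + 1) / (n + 1)) =
      ∏ k ∈ range n, Real.Gamma (1 - ((k : ℝ) + 1) / (n + 1)) := by
    rw [← prod_range_reflect]
    refine prod_congr rfl fun k hk => ?_
    have hk' := Finset.mem_range.mp hk
    congr 1
    rw [Nat.sub_sub, Nat.cast_sub (by omega)]
    push_cast
    field_simp
    ring
  have hsq : (∏ k ∈ range n, Real.Gamma (((k : ℝ) + 1) / (n + 1))) ^ 2 =
      (2 * Real.pi) ^ n / (n + 1) := by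
    rw [sq]
    nth_rw 2 [hrefl]
    rw [← prod_mul_distrib]
    simp_rw [Real.Gamma_mul_Gamma_one_sub]
    rw [eq_div_iff hn.ne']
    refine (congrArg _ (prod_two_mul_sin_pi_div n).symm).trans ?_
    rw [← prod_mul_distrib]
    refine (prod_congr rfl fun k hk => ?_).trans
      ((prod_const (2 * Real.pi)).trans (by rw [Finset.card_range]))
    have hk' : (k : ℝ) + 1 ≤ n := by exact_mod_cast Finset.mem_range.mp hk
    have : Real.sin (Real.pi * ((k + 1) / (n + 1))) ≠ 0 := by
      refine (Real.sin_pos_of_pos_of_lt_pi (by positivity) ?_).ne'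
      have : ((k : ℝ) + 1) / (n + 1) < 1 := by rw [div_lt_one hn]; linarith
      nlinarith [Real.pi_pos]
    rw [div_mul_eq_mul_div, div_eq_iff this]
    ring
  refine (sq_eq_sq₀ (prod_nonneg fun k hk => (hpos k hk).le) (by positivity)).mp ?_
  have h1 : ((2 * Real.pi) ^ ((n : ℝ) / 2)) ^ 2 = (2 * Real.pi) ^ n := by
    rw [← Real.rpow_natCast, ← Real.rpow_natCast, ← Real.rpow_mul (by positivity)]
    norm_num
  have h2 : ((n + 1 : ℝ) ^ (-1 / 2 : ℝ)) ^ 2 = (n + 1 : ℝ)⁻¹ := by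
    rw [← Real.rpow_natCast, ← Real.rpow_mul hn.le]
    norm_num
    rw [Real.rpow_neg_one]
  rw [hsq, mul_pow ((2 * Real.pi) ^ ((n : ℝ) / 2)), h1, h2, div_eq_mul_inv]

lemma convexOn_log_Gamma_add_div (n : ℕ) (k : ℝ) (hk : 0 ≤ k) :
    ConvexOn ℝ (Set.Ioi 0) fun s : ℝ => Real.log (Real.Gamma ((s + k) / (n + 1))) := by
  have hn : (0 : ℝ) < n + 1 := by positivity
  refine ⟨convex_Ioi 0, fun x hx y hy a b ha hb hab => ?_⟩
  have hx' : (0 : ℝ) < (x + k) / (n + 1) := div_pos (add_pos_of_pos_of_nonneg hx hk) hn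
  have hy' : (0 : ℝ) < (y + k) / (n + 1) := div_pos (add_pos_of_pos_of_nonneg hy hk) hn
  have := Real.convexOn_log_Gamma.2 hx' hy' ha hb hab
  simp only [smul_eq_mul, Function.comp_apply] at this ⊢
  convert this using 3
  obtain rfl : b = 1 - a := by linarith
  field_simp
  ring

/-- The multiplication formula of Gauss for the Gamma function at positive real arguments. -/
theorem Real.prod_Gamma_add_div_of_pos (n : ℕ) {s : ℝ} (hs : 0 < s) :
    ∏ k ∈ range (n + 1), Real.Gamma ((s + k) / (n + 1)) =
      (2 * Real.pi) ^ ((n : ℝ) / 2) * (n + 1 : ℝ) ^ (1 / 2 - s) * Real.Gamma s := by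
  have hn : (0 : ℝ) < n + 1 := by positivity
  set c : ℝ := (2 * Real.pi) ^ ((n : ℝ) / 2) with hc
  have hcpos : 0 < c := by positivity
  -- The candidate for Γ: by Bohr–Mollerup, the functional equation, the value 1 at 1 and
  -- log-convexity identify f with Γ on the positive axis.
  let f : ℝ → ℝ := fun s =>
    (∏ k ∈ range (n + 1), Real.Gamma ((s + k) / (n + 1))) * (n + 1 : ℝ) ^ (s - 1 / 2) / c
  have hG : ∀ {s : ℝ}, 0 < s → ∀ k : ℕ, 0 < Real.Gamma ((s + k) / (n + 1)) := fun hs k =>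
    Real.Gamma_pos_of_pos (by positivity)
  have hpos : ∀ {s : ℝ}, 0 < s → 0 < f s := fun hs =>
    div_pos (mul_pos (prod_pos fun k _ => hG hs k) (by positivity)) hcpos
  have hfeq : ∀ {y : ℝ}, 0 < y → f (y + 1) = y * f y := by
    intro y hy
    have h1 : ∏ k ∈ range (n + 1), Real.Gamma ((y + 1 + k) / (n + 1)) =
        y / (n + 1) * ∏ k ∈ range (n + 1), Real.Gamma ((y + k) / (n + 1)) := by
      rw [prod_range_succ, prod_range_succ' (fun k : ℕ => Real.Gamma ((y + k) / (n + 1)))]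
      have : (y + 1 + n) / (n + 1) = (y + (0 : ℕ)) / (n + 1) + 1 := by
        push_cast; field_simp; ring
      rw [this, Real.Gamma_add_one (by push_cast; positivity)]
      have : ∀ k : ℕ, y + 1 + (k : ℝ) = y + ((k + 1 : ℕ) : ℝ) := fun k => by push_cast; ring
      simp_rw [this]
      push_cast
      ring
    simp only [f, h1]
    rw [show y + 1 - 1 / 2 = (y - 1 / 2) + 1 by ring, Real.rpow_add_one hn.ne']
    field_simp
  have hone : f 1 = 1 := by
    simp only [f]
    rw [prod_range_succ]
    have : ∀ k : ℕ, (1 : ℝ) + k = k + 1 := fun k => add_comm _ _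
    simp_rw [this, div_self hn.ne', Real.Gamma_one, mul_one]
    rw [prod_Gamma_succ_div, ← hc, mul_assoc, ← Real.rpow_add hn]
    norm_num
    exact hcpos.ne'
  have hconv : ConvexOn ℝ (Set.Ioi 0) (Real.log ∘ f) := by
    have h1 : ConvexOn ℝ (Set.Ioi (0 : ℝ)) fun s : ℝ =>
        ∑ k ∈ range (n + 1), Real.log (Real.Gamma ((s + k) / (n + 1))) := by
      induction range (n + 1) using Finset.cons_induction with
      | empty => simpa using convexOn_const (0 : ℝ) (convex_Ioi (0 : ℝ))
      | cons k t hk ih =>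
        simp_rw [sum_cons]
        exact (convexOn_log_Gamma_add_div n k (Nat.cast_nonneg k)).add ih
    have h2 : ConvexOn ℝ (Set.Ioi (0 : ℝ)) fun s : ℝ =>
        (s - 1 / 2) * Real.log (n + 1) - Real.log c := by
      refine ⟨convex_Ioi 0, fun x _ y _ a b _ _ hab => le_of_eq ?_⟩
      obtain rfl : b = 1 - a := by linarith
      simp only [smul_eq_mul]
      ring
    refine (h1.add h2).congr fun s hs => ?_
    have h3 : ∏ k ∈ range (n + 1), Real.Gamma ((s + k) / (n + 1)) ≠ 0 :=
      (prod_pos fun k _ => hG hs k).ne'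
    simp only [Pi.add_apply, Function.comp_apply, f]
    rw [Real.log_div (by positivity) hcpos.ne', Real.log_mul h3 (by positivity),
      Real.log_prod fun k _ => (hG hs k).ne', Real.log_rpow hn]
    ring
  have := Real.eq_Gamma_of_log_convex hconv hfeq hpos hone hs
  rw [← this]
  simp only [f]
  have h2 : (n + 1 : ℝ) ^ (1 / 2 - s) * (n + 1 : ℝ) ^ (s - 1 / 2) = 1 := by
    rw [← Real.rpow_add hn]; simp
  rw [mul_assoc, mul_div_assoc', mul_div_cancel₀ _ hcpos.ne']
  linear_combination (-∏ k ∈ range (n + 1), Real.Gamma ((s + k) / (n + 1))) * h2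

/-- The multiplication formula of Gauss for the complex Gamma function. -/
theorem Complex.prod_Gamma_add_div {n : ℕ} (hn : n ≠ 0) (s : ℂ) :
    ∏ k ∈ range n, Gamma ((s + k) / n) =
      (2 * (Real.pi : ℂ)) ^ (((n : ℂ) - 1) / 2) * (n : ℂ) ^ (1 / 2 - s) * Gamma s := by
  obtain ⟨n, rfl⟩ := Nat.exists_eq_succ_of_ne_zero hn
  have hn0 : ((n + 1 : ℕ) : ℂ) ≠ 0 := Nat.cast_ne_zero.mpr (Nat.succ_ne_zero n)
  have hpi : (2 * (Real.pi : ℂ)) ≠ 0 := by simp [Real.pi_ne_zero]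
  -- Passing to reciprocals makes both sides entire, so the identity theorem applies on the whole
  -- plane without poles to avoid.
  suffices (fun z : ℂ => ∏ k ∈ range (n + 1), (Gamma ((z + k) / (n + 1 : ℕ)))⁻¹) = fun z =>
      (2 * (Real.pi : ℂ)) ^ (-(n : ℂ) / 2) * ((n + 1 : ℕ) : ℂ) ^ (z - 1 / 2) * (Gamma z)⁻¹ by
    have h := congr_arg Inv.inv (congr_fun this s)
    simp only [prod_inv_distrib, inv_inv, mul_inv, ← cpow_neg] at h
    rw [h]
    congr 3
    · push_cast; ring
    · ring
  have h1 : AnalyticOnNhd ℂ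
      (fun z : ℂ => ∏ k ∈ range (n + 1), (Gamma ((z + k) / (n + 1 : ℕ)))⁻¹) Set.univ := by
    refine DifferentiableOn.analyticOnNhd (Differentiable.differentiableOn ?_) isOpen_univ
    refine Differentiable.fun_finsetProd fun k _ => ?_
    exact differentiable_one_div_Gamma.comp
      ((differentiable_id.add (differentiable_const _)).div_const _)
  have h2 : AnalyticOnNhd ℂ (fun z : ℂ => (2 * (Real.pi : ℂ)) ^ (-(n : ℂ) / 2) *
      ((n + 1 : ℕ) : ℂ) ^ (z - 1 / 2) * (Gamma z)⁻¹) Set.univ := by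
    refine DifferentiableOn.analyticOnNhd (Differentiable.differentiableOn ?_) isOpen_univ
    refine Differentiable.mul (Differentiable.mul (differentiable_const _) ?_)
      differentiable_one_div_Gamma
    exact fun t => DifferentiableAt.const_cpow (differentiableAt_id.sub_const _) (Or.inl hn0)
  -- The real identity holds near 1 on the positive axis, and these points accumulate at 1.
  have h3 : Filter.Tendsto ((↑) : ℝ → ℂ) (nhdsWithin 1 {1}ᶜ) (nhdsWithin 1 {1}ᶜ) := by
    rw [tendsto_nhdsWithin_iff]
    exact ⟨tendsto_nhdsWithin_of_tendsto_nhds continuous_ofReal.continuousAt,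
      eventually_nhdsWithin_iff.mpr (Filter.Eventually.of_forall fun t ht => ofReal_ne_one.mpr ht)⟩
  refine AnalyticOnNhd.eq_of_frequently_eq h1 h2 (h3.frequently ?_)
  refine ((Filter.Eventually.filter_mono nhdsWithin_le_nhds) ?_).frequently
  refine (eventually_gt_nhds zero_lt_one).mp (Filter.Eventually.of_forall fun t ht => ?_)
  have h := congrArg (fun x : ℝ => ((x⁻¹ : ℝ) : ℂ)) (Real.prod_Gamma_add_div_of_pos n ht)
  simp only [mul_inv, ← prod_inv_distrib] at h
  rw [← Real.rpow_neg (by positivity), ← Real.rpow_neg (by positivity)] at h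
  push_cast [Complex.ofReal_cpow (show (0 : ℝ) ≤ 2 * Real.pi by positivity),
    Complex.ofReal_cpow (show (0 : ℝ) ≤ n + 1 by positivity), ← Gamma_ofReal] at h ⊢
  rw [h, neg_div, neg_sub]

end GaussMultiplication

/-! ### Independence of the vertical line of integration. -/

section ContourShift

open Filter Topology

/-- The integral of a holomorphic function along a vertical line does not depend on the line if
the function tends to zero uniformly at the ends of the strip between two lines. -/
lemma integral_vertical_eq_of_tendsto_zero {F : ℂ → ℂ} {σ τ : ℝ} {φ : ℝ → ℝ}
    (hd : ∀ s : ℂ, s.re ∈ Set.uIcc σ τ → DifferentiableAt ℂ F s)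
    (hφ : Tendsto φ atTop (𝓝 0))
    (hF : ∀ s : ℂ, s.re ∈ Set.uIcc σ τ → ‖F s‖ ≤ φ |s.im|)
    (h1 : VerticalIntegrable F σ) (h2 : VerticalIntegrable F τ) :
    ∫ y : ℝ, F (σ + y * I) = ∫ y : ℝ, F (τ + y * I) := by
  have hrect : ∀ T : ℝ, (∫ y in (-T)..T, F (σ + y * I)) - ∫ y in (-T)..T, F (τ + y * I) =
      -I * ((∫ x in σ..τ, F (x + (-T : ℝ) * I)) - ∫ x in σ..τ, F (x + T * I)) := by
    intro T
    have h := integral_boundary_rect_eq_zero_of_differentiableOn F ⟨σ, -T⟩ ⟨τ, T⟩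
      (fun s hs => (hd s hs.1).differentiableWithinAt)
    simp only [smul_eq_mul] at h
    linear_combination I * h + ((∫ y in (-T)..T, F (σ + y * I)) -
      ∫ y in (-T)..T, F (τ + y * I)) * I_sq
  have hhor : ∀ T : ℝ, 0 ≤ T →
      ‖-I * ((∫ x in σ..τ, F (x + (-T : ℝ) * I)) - ∫ x in σ..τ, F (x + T * I))‖ ≤
        2 * |τ - σ| * φ T := by
    intro T hT
    have hx : ∀ (T' : ℝ), |T'| = T → ‖∫ x in σ..τ, F (x + T' * I)‖ ≤ φ T * |τ - σ| := by
      intro T' hT'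
      refine intervalIntegral.norm_integral_le_of_norm_le_const fun x hx => ?_
      have := hF (x + T' * I) (by simpa using Set.uIoc_subset_uIcc hx)
      simpa [hT'] using this
    rw [norm_mul, norm_neg, norm_I, one_mul]
    refine (norm_sub_le _ _).trans ?_
    have := hx (-T) (by rw [abs_neg, abs_of_nonneg hT])
    have := hx T (abs_of_nonneg hT)
    linarith
  have hlim : Tendsto (fun T : ℝ => (∫ y in (-T)..T, F (σ + y * I)) -
      ∫ y in (-T)..T, F (τ + y * I)) atTop (𝓝 0) := by
    simp_rw [hrect]
    refine squeeze_zero_norm' ((eventually_ge_atTop 0).mono hhor) ?_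
    simpa using hφ.const_mul (2 * |τ - σ|)
  have h3 := (intervalIntegral_tendsto_integral h1 tendsto_neg_atTop_atBot tendsto_id).sub
    (intervalIntegral_tendsto_integral h2 tendsto_neg_atTop_atBot tendsto_id)
  exact sub_eq_zero.mp (tendsto_nhds_unique h3 hlim)

lemma norm_exp_mul_sq (ε : ℝ) (s : ℂ) :
    ‖cexp (ε * s ^ 2)‖ = Real.exp (ε * (s.re ^ 2 - s.im ^ 2)) := by
  rw [norm_exp]
  congr 1
  simp [sq]

/-- The Gaussian factor can be removed in the limit ε → 0: for 0 ≤ ε ≤ 1 its modulus on the line is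
at most exp(σ²), which dominates. -/
lemma tendsto_integral_exp_mul_sq_mul {F : ℂ → ℂ} {σ : ℝ} (h : VerticalIntegrable F σ) :
    Tendsto (fun n : ℕ => ∫ y : ℝ, cexp ((1 / ((n : ℝ) + 1) : ℝ) * ((σ : ℂ) + y * I) ^ 2) *
      F (σ + y * I)) atTop (𝓝 (∫ y : ℝ, F (σ + y * I))) := by
  refine tendsto_integral_of_dominated_convergence
    (fun y => Real.exp (σ ^ 2) * ‖F (σ + y * I)‖) (fun n => ?_) (h.norm.const_mul _)
    (fun n => Eventually.of_forall fun y => ?_) (Eventually.of_forall fun y => ?_)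
  · exact (Continuous.aestronglyMeasurable (by fun_prop)).mul h.aestronglyMeasurable
  · rw [norm_mul, norm_exp_mul_sq]
    refine mul_le_mul_of_nonneg_right (Real.exp_le_exp.mpr ?_) (norm_nonneg _)
    have h1 : (1 / ((n : ℝ) + 1)) ≤ 1 := by
      rw [div_le_one (by positivity)]; linarith [Nat.cast_nonneg (α := ℝ) n]
    have h2 : 0 ≤ (1 / ((n : ℝ) + 1)) := by positivity
    simp only [add_re, ofReal_re, mul_re, I_re, mul_zero, ofReal_im, I_im, mul_one, sub_self,
      add_zero, add_im, mul_im, zero_add]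
    nlinarith [sq_nonneg σ, sq_nonneg y, mul_nonneg h2 (sq_nonneg y),
      mul_nonneg (sub_nonneg.mpr h1) (sq_nonneg σ)]
  · have h1 : Tendsto (fun n : ℕ => cexp ((1 / ((n : ℝ) + 1) : ℝ) * ((σ : ℂ) + y * I) ^ 2)) atTop
        (𝓝 (cexp ((0 : ℝ) * ((σ : ℂ) + y * I) ^ 2))) := by
      refine (continuous_exp.tendsto _).comp (Tendsto.mul_const _ ?_)
      exact (continuous_ofReal.tendsto _).comp tendsto_one_div_add_atTop_nhds_zero_nat
    simpa using h1.mul_const (F (σ + y * I))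

/-- The integral of a holomorphic function of at most exponential growth along a vertical line is
the same for any two lines along which it converges absolutely. -/
theorem integral_vertical_eq {F : ℂ → ℂ} {σ τ C D : ℝ}
    (hd : ∀ s : ℂ, s.re ∈ Set.uIcc σ τ → DifferentiableAt ℂ F s)
    (hF : ∀ s : ℂ, s.re ∈ Set.uIcc σ τ → ‖F s‖ ≤ C * Real.exp (D * |s.im|))
    (h1 : VerticalIntegrable F σ) (h2 : VerticalIntegrable F τ) :
    ∫ y : ℝ, F (σ + y * I) = ∫ y : ℝ, F (τ + y * I) := by
  refine tendsto_nhds_unique (tendsto_integral_exp_mul_sq_mul h1) ?_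
  refine (tendsto_integral_exp_mul_sq_mul h2).congr fun n => ?_
  have hε : (0 : ℝ) < 1 / ((n : ℝ) + 1) := by positivity
  set ε : ℝ := 1 / ((n : ℝ) + 1)
  have hint : ∀ {σ : ℝ}, VerticalIntegrable F σ →
      VerticalIntegrable (fun s => cexp (ε * s ^ 2) * F s) σ := by
    intro σ h
    refine Integrable.bdd_mul (c := Real.exp (ε * σ ^ 2)) h
      (Continuous.aestronglyMeasurable (by fun_prop)) (Eventually.of_forall fun y => ?_)
    rw [norm_exp_mul_sq]
    refine Real.exp_le_exp.mpr (mul_le_mul_of_nonneg_left ?_ hε.le)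
    simp only [add_re, ofReal_re, mul_re, I_re, mul_zero, ofReal_im, I_im, mul_one, sub_self,
      add_zero, add_im, mul_im, zero_add]
    nlinarith [sq_nonneg y]
  set M := max |σ| |τ|
  -- On the strip, exp(εs²) decays like exp(-εT²) at height T and so beats the growth exp(DT).
  refine (integral_vertical_eq_of_tendsto_zero (F := fun s => cexp (ε * s ^ 2) * F s)
    (φ := fun T => Real.exp (ε * M ^ 2) * |C| * Real.exp (-(T * (ε * T + -D))))
    (fun s hs => DifferentiableAt.mul (by fun_prop) (hd s hs)) ?_ (fun s hs => ?_)
    (hint h1) (hint h2)).symm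
  · have : Tendsto (fun T : ℝ => T * (ε * T + -D)) atTop atTop :=
      tendsto_id.atTop_mul_atTop₀
        (tendsto_atTop_add_const_right _ _ (tendsto_id.const_mul_atTop hε))
    simpa using (Real.tendsto_exp_neg_atTop_nhds_zero.comp this).const_mul
      (Real.exp (ε * M ^ 2) * |C|)
  · have hM : s.re ^ 2 ≤ M ^ 2 := by
      refine sq_le_sq' ?_ ?_ <;>
      · rcases Set.mem_uIcc.mp hs with h | h <;>
        · have := neg_abs_le σ
          have := neg_abs_le τ
          have := le_abs_self σ
          have := le_abs_self τ
          have := le_max_left |σ| |τ|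
          have := le_max_right |σ| |τ|
          simp only [M]
          linarith
    rw [norm_mul, norm_exp_mul_sq]
    calc Real.exp (ε * (s.re ^ 2 - s.im ^ 2)) * ‖F s‖
        ≤ Real.exp (ε * (M ^ 2 - s.im ^ 2)) * (|C| * Real.exp (D * |s.im|)) := by
          gcongr
          exact (hF s hs).trans (mul_le_mul_of_nonneg_right (le_abs_self C) (Real.exp_pos _).le)
      _ = _ := by
          rw [mul_left_comm, mul_comm (Real.exp (ε * M ^ 2)), mul_assoc, ← Real.exp_add,
            ← Real.exp_add, ← sq_abs s.im]
          ring_nf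

end ContourShift

/-! ### Crude bounds for Γ and 1/Γ in vertical strips. -/

section GammaCrude

lemma norm_Gamma_le_Gamma_re {s : ℂ} (hs : 0 < s.re) : ‖Gamma s‖ ≤ Real.Gamma s.re := by
  rw [Gamma_eq_integral hs, Real.Gamma_eq_integral hs, GammaIntegral]
  refine (norm_integral_le_integral_norm _).trans (le_of_eq ?_)
  refine setIntegral_congr_fun measurableSet_Ioi fun x hx => ?_
  simp only [norm_mul]
  rw [Complex.norm_of_nonneg (Real.exp_pos _).le, norm_cpow_eq_rpow_re_of_pos hx]
  simp

lemma exists_norm_Gamma_le {a : ℝ} (ha : 0 < a) (b : ℝ) :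
    ∃ C : ℝ, 0 < C ∧ ∀ s : ℂ, a ≤ s.re → s.re ≤ b → ‖Gamma s‖ ≤ C := by
  have hc : ContinuousOn Real.Gamma (Set.Icc a b) := fun x hx =>
    (Real.differentiableAt_Gamma fun m => by
      have : 0 < x := ha.trans_le hx.1
      have : (0 : ℝ) ≤ m := Nat.cast_nonneg m
      linarith).continuousAt.continuousWithinAt
  obtain ⟨C, hC⟩ := isCompact_Icc.exists_bound_of_continuousOn hc
  refine ⟨max C 1, by positivity, fun s h1 h2 => ?_⟩
  refine (norm_Gamma_le_Gamma_re (ha.trans_le h1)).trans ?_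
  exact (le_abs_self _).trans ((hC s.re ⟨h1, h2⟩).trans (le_max_left _ _))

lemma norm_sin_le_exp (s : ℂ) : ‖sin s‖ ≤ Real.exp |s.im| := by
  rw [sin, norm_div, norm_mul, norm_I, mul_one]
  have h1 : ‖cexp (-s * I)‖ ≤ Real.exp |s.im| := by
    rw [norm_exp]; refine Real.exp_le_exp.mpr ?_; simpa using le_abs_self s.im
  have h2 : ‖cexp (s * I)‖ ≤ Real.exp |s.im| := by
    rw [norm_exp]; refine Real.exp_le_exp.mpr ?_; simpa using neg_le_abs s.im
  have h3 : ‖(2 : ℂ)‖ = 2 := by simp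
  rw [h3, div_le_iff₀ two_pos]
  linarith [norm_sub_le (cexp (-s * I)) (cexp (s * I))]

lemma inv_Gamma_eq_of_re_lt_one {s : ℂ} (hs : s.re < 1) :
    (Gamma s)⁻¹ = Gamma (1 - s) * (sin (Real.pi * s) / Real.pi) := by
  have h := Gamma_mul_Gamma_one_sub s
  have h1 : Gamma (1 - s) ≠ 0 := Gamma_ne_zero_of_re_pos (by simpa using hs)
  rw [← eq_div_iff h1] at h
  rw [h, inv_div, div_div_eq_mul_div, mul_div_assoc]

/-- The reciprocal Gamma function is of at most exponential growth in vertical strips. -/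
lemma exists_norm_inv_Gamma_le (a b : ℝ) :
    ∃ C : ℝ, 0 < C ∧ ∀ s : ℂ, a ≤ s.re → s.re ≤ b →
      ‖(Gamma s)⁻¹‖ ≤ C * Real.exp (Real.pi * |s.im|) := by
  -- N counts the unit shifts that bring the strip into Re s < 1, where the reflection formula
  -- bounds 1/Γ(s) by a bounded Γ(1-s) times a sine.
  obtain ⟨N, hN⟩ := exists_nat_gt (b - 1)
  induction N generalizing a b with
  | zero =>
    have hb : b < 1 := by simpa using hN
    obtain ⟨C, hC, h⟩ := exists_norm_Gamma_le (a := 1 - b) (by linarith) (1 - a)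
    refine ⟨C, hC, fun s h1 h2 => ?_⟩
    rw [inv_Gamma_eq_of_re_lt_one (by linarith), norm_mul]
    refine mul_le_mul (h _ (by rw [sub_re, one_re]; linarith) (by rw [sub_re, one_re]; linarith)) ?_
      (norm_nonneg _) hC.le
    rw [norm_div, Complex.norm_of_nonneg Real.pi_pos.le]
    refine (div_le_self (norm_nonneg _) (by linarith [Real.pi_gt_three])).trans ?_
    refine (norm_sin_le_exp _).trans (le_of_eq ?_)
    rw [im_ofReal_mul, abs_mul, abs_of_pos Real.pi_pos]
  | succ N ih =>
    obtain ⟨C, hC, h⟩ := ih (a - 1) (b - 1) (by push_cast at hN; linarith)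
    have hK : IsCompact (Set.Icc a b ×ℂ Set.Icc (-1) 1) := isCompact_Icc.reProdIm isCompact_Icc
    obtain ⟨C', hC'⟩ := hK.exists_bound_of_continuousOn
      differentiable_one_div_Gamma.continuous.continuousOn
    refine ⟨max C C', lt_max_of_lt_left hC, fun s h1 h2 => ?_⟩
    have hexp : 1 ≤ Real.exp (Real.pi * |s.im|) := Real.one_le_exp (by positivity)
    -- The shift divides by s - 1, which is harmless once |Im s| ≥ 1; the remaining rectangle is
    -- compact and 1/Γ is entire.
    rcases le_total |s.im| 1 with hs | hs
    · refine (hC' s ⟨⟨h1, h2⟩, abs_le.mp hs⟩).trans ((le_max_right C C').trans ?_)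
      exact le_mul_of_one_le_right (hC.le.trans (le_max_left _ _)) hexp
    · have hs1 : 1 ≤ ‖s - 1‖ := hs.trans (by simpa using abs_im_le_norm (s - 1))
      have hne : s - 1 ≠ 0 := by rw [← norm_pos_iff]; linarith
      have h3 := h (s - 1) (by simpa using h1) (by simpa using h2)
      have h4 : Gamma s = (s - 1) * Gamma (s - 1) := by
        rw [← Gamma_add_one _ hne, sub_add_cancel]
      rw [h4, mul_inv, norm_mul]
      calc ‖(s - 1)⁻¹‖ * ‖(Gamma (s - 1))⁻¹‖ ≤ 1 * ‖(Gamma (s - 1))⁻¹‖ := by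
            gcongr
            rw [norm_inv]
            exact inv_le_one_of_one_le₀ hs1
        _ ≤ C * Real.exp (Real.pi * |s.im|) := by simpa using h3
        _ ≤ _ := by gcongr; exact le_max_left _ _

end GammaCrude

/-! ### Stirling's formula up to bounded factors in the strip 1/2 ≤ Re s ≤ 3/2. -/

section Stirling

open Filter Topology Asymptotics

lemma im_mul_arg_le {s : ℂ} (hs : 0 < s.re) : s.im * arg s ≤ Real.pi / 2 * |s.im| := by
  calc s.im * arg s ≤ |s.im * arg s| := le_abs_self _
    _ = |arg s| * |s.im| := by rw [abs_mul, mul_comm]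
    _ ≤ _ := by
      gcongr
      exact abs_arg_le_pi_div_two_iff.mpr hs.le

lemma im_mul_arg_eq_abs (s : ℂ) : s.im * arg s = |s.im| * |arg s| := by
  rcases le_or_gt 0 s.im with h | h
  · rw [abs_of_nonneg h, abs_of_nonneg (arg_nonneg_iff.mpr h)]
  · rw [abs_of_neg h, abs_of_neg (arg_neg_iff.mpr h), neg_mul_neg]

/-- With θ = π/2 - |arg s| one has θ ≤ tan θ = Re s / |Im s|. Together with `im_mul_arg_le` this
lets exp(Im s · arg s) be replaced by exp(π|Im s|/2), up to bounded factors in a strip. -/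
lemma le_im_mul_arg {s : ℂ} (hs : 0 < s.re) : Real.pi / 2 * |s.im| - s.re ≤ s.im * arg s := by
  rw [im_mul_arg_eq_abs]
  rcases eq_or_ne s.im 0 with h | h
  · rw [h]; simp [hs.le]
  have hpos : 0 < |s.im| := abs_pos.mpr h
  have hne : s ≠ 0 := fun h0 => h (by simp [h0])
  have harg : 0 < |arg s| := abs_pos.mpr fun h0 => h (arg_eq_zero_iff.mp h0).2
  have hlt : |arg s| < Real.pi / 2 := abs_arg_lt_pi_div_two_iff.mpr (Or.inl hs)
  have h1 := Real.le_tan (x := Real.pi / 2 - |arg s|) (by linarith) (by linarith)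
  have hsin : Real.sin |arg s| = |s.im| / ‖s‖ := by
    rcases abs_cases (arg s) with ⟨h2, h3⟩ | ⟨h2, h3⟩
    · rw [h2, sin_arg, abs_of_nonneg (arg_nonneg_iff.mp h3)]
    · rw [h2, Real.sin_neg, sin_arg, abs_of_neg (arg_neg_iff.mp h3), neg_div]
  have hcos : Real.cos |arg s| = s.re / ‖s‖ := by rw [Real.cos_abs, cos_arg hne]
  rw [Real.tan_pi_div_two_sub, Real.tan_eq_sin_div_cos, hsin, hcos, inv_div,
    div_div_div_cancel_right₀ (norm_ne_zero_iff.mpr hne), le_div_iff₀ hpos] at h1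
  linarith

/-- The quotient of the Gamma function by the main term of the formula of Stirling. -/
noncomputable def stirlingQuotient (s : ℂ) : ℂ :=
  Gamma s * cexp (s - (s - 1 / 2) * log s)

lemma norm_stirlingQuotient {s : ℂ} (hs : 0 < s.re) :
    ‖stirlingQuotient s‖ =
      ‖Gamma s‖ * (Real.exp s.re * ‖s‖ ^ (1 / 2 - s.re) * Real.exp (s.im * arg s)) := by
  have hne : s ≠ 0 := fun h => by simp [h] at hs
  rw [stirlingQuotient, norm_mul, norm_exp, Real.rpow_def_of_pos (norm_pos_iff.mpr hne),
    ← Real.exp_add, ← Real.exp_add]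
  congr 2
  simp [log_re, log_im]
  ring

lemma differentiableAt_stirlingQuotient {s : ℂ} (hs : 0 < s.re) :
    DifferentiableAt ℂ stirlingQuotient s := by
  have hne : ∀ m : ℕ, s ≠ -m := fun m h => by
    have := congrArg re h
    have h2 : (0 : ℝ) ≤ m := Nat.cast_nonneg m
    simp at this
    linarith
  have hl : DifferentiableAt ℂ log s := differentiableAt_log (Or.inl hs)
  exact (differentiableAt_Gamma s hne).mul (by fun_prop)

lemma stirlingQuotient_ne_zero {s : ℂ} (hs : 0 < s.re) : stirlingQuotient s ≠ 0 :=
  mul_ne_zero (Gamma_ne_zero_of_re_pos hs) (exp_ne_zero _)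

/-- On Re s = 1/2 the point 1 - s is the conjugate of s, so the reflection formula computes |Γ(s)|²
exactly. -/
lemma norm_sq_Gamma_half_add (y : ℝ) :
    ‖Gamma (1 / 2 + y * I)‖ ^ 2 = Real.pi / Real.cosh (Real.pi * y) := by
  have h := Gamma_mul_Gamma_one_sub (1 / 2 + y * I)
  have h1 : (1 : ℂ) - (1 / 2 + y * I) = (starRingEnd ℂ) (1 / 2 + y * I) := by
    simp only [map_add, map_div₀, map_one, map_ofNat, map_mul, conj_ofReal, conj_I]; ring
  have h2 : sin (Real.pi * (1 / 2 + y * I)) = Real.cosh (Real.pi * y) := by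
    rw [show (Real.pi : ℂ) * (1 / 2 + y * I) = ((Real.pi * y : ℝ) : ℂ) * I + Real.pi / 2 by
      push_cast; ring, sin_add_pi_div_two, cos_mul_I]
    simp
  rw [h1, Gamma_conj, mul_conj, h2, normSq_eq_norm_sq] at h
  exact_mod_cast h

/-- A holomorphic function of at most exponential growth in the strip `1/2 ≤ Re s ≤ 3/2` is
bounded there by its bound on the boundary. -/
lemma norm_le_of_norm_le_boundary {f : ℂ → ℂ} {A B D C : ℝ}
    (hd : ∀ s : ℂ, 0 < s.re → DifferentiableAt ℂ f s)
    (hB : ∀ s : ℂ, 1 / 2 ≤ s.re → s.re ≤ 3 / 2 → ‖f s‖ ≤ A * Real.exp (D * |s.im|))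
    (h1 : ∀ s : ℂ, s.re = 1 / 2 → ‖f s‖ ≤ B) (h2 : ∀ s : ℂ, s.re = 3 / 2 → ‖f s‖ ≤ C) :
    ∀ s : ℂ, 1 / 2 ≤ s.re → s.re ≤ 3 / 2 → ‖f s‖ ≤ max B C := by
  intro s hs1 hs2
  refine PhragmenLindelof.vertical_strip (a := 1 / 2) (b := 3 / 2) (f := f) ?_ ?_
    (fun z hz => (h1 z hz).trans (le_max_left _ _)) (fun z hz => (h2 z hz).trans (le_max_right _ _))
    hs1 hs2
  · refine DifferentiableOn.diffContOnCl fun z hz => (hd z ?_).differentiableWithinAt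
    rw [closure_preimage_re, closure_Ioo (by norm_num)] at hz
    exact lt_of_lt_of_le (by norm_num) hz.1
  -- Phragmén–Lindelöf in a strip of width 1 admits growth exp(B exp(c|Im z|)) with c < π; here c =
  -- 1.
  · refine ⟨1, ?_, |D|, ?_⟩
    · norm_num; linarith [Real.pi_gt_three]
    · refine IsBigO.of_bound |A| ?_
      refine mem_inf_of_right fun z hz => ?_
      have hz' : z.re ∈ Set.Ioo (1 / 2 : ℝ) (3 / 2) := hz
      refine (hB z hz'.1.le hz'.2.le).trans ?_
      rw [Real.norm_of_nonneg (Real.exp_pos _).le, one_mul]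
      gcongr
      · exact le_abs_self A
      · exact le_abs_self D
      · linarith [Real.add_one_le_exp |z.im|]

lemma norm_sq_stirlingQuotient_half {s : ℂ} (hs : s.re = 1 / 2) :
    ‖stirlingQuotient s‖ ^ 2 =
      Real.pi / Real.cosh (Real.pi * s.im) * Real.exp (1 + 2 * (s.im * arg s)) := by
  have hG : Gamma s = Gamma (1 / 2 + s.im * I) := by
    conv_lhs => rw [← re_add_im s, hs]
    push_cast; rfl
  rw [norm_stirlingQuotient (by rw [hs]; norm_num), hs, mul_pow, hG, norm_sq_Gamma_half_add,
    sub_self, Real.rpow_zero, mul_one, ← Real.exp_add, ← Real.exp_nat_mul]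
  congr 2
  push_cast
  ring

lemma half_exp_abs_le_cosh (x : ℝ) : Real.exp |x| / 2 ≤ Real.cosh x := by
  rw [← Real.cosh_abs, Real.cosh_eq]
  linarith [Real.exp_pos (-|x|)]

lemma cosh_le_exp_abs (x : ℝ) : Real.cosh x ≤ Real.exp |x| := by
  rw [← Real.cosh_abs, Real.cosh_eq]
  have : Real.exp (-|x|) ≤ Real.exp |x| := Real.exp_le_exp.mpr (by linarith [abs_nonneg x])
  linarith

lemma norm_stirlingQuotient_half_le {s : ℂ} (hs : s.re = 1 / 2) :
    ‖stirlingQuotient s‖ ≤ √(2 * Real.pi * Real.exp 1) := by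
  refine Real.le_sqrt_of_sq_le ?_
  rw [norm_sq_stirlingQuotient_half hs, div_mul_eq_mul_div, div_le_iff₀ (Real.cosh_pos _)]
  have h1 := half_exp_abs_le_cosh (Real.pi * s.im)
  have h2 := im_mul_arg_le (s := s) (by rw [hs]; norm_num)
  rw [abs_mul, abs_of_pos Real.pi_pos] at h1
  calc Real.pi * Real.exp (1 + 2 * (s.im * arg s))
      ≤ Real.pi * Real.exp (1 + Real.pi * |s.im|) :=
        mul_le_mul_of_nonneg_left (Real.exp_le_exp.mpr (by linarith)) Real.pi_pos.le
    _ = 2 * Real.pi * Real.exp 1 * (Real.exp (Real.pi * |s.im|) / 2) := by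
      rw [Real.exp_add]; ring
    _ ≤ _ := by gcongr

lemma one_le_norm_stirlingQuotient_half {s : ℂ} (hs : s.re = 1 / 2) :
    1 ≤ ‖stirlingQuotient s‖ := by
  rw [← one_le_sq_iff₀ (norm_nonneg _), norm_sq_stirlingQuotient_half hs, div_mul_eq_mul_div,
    le_div_iff₀ (Real.cosh_pos _), one_mul]
  have h1 := cosh_le_exp_abs (Real.pi * s.im)
  have h2 := le_im_mul_arg (s := s) (by rw [hs]; norm_num)
  rw [abs_mul, abs_of_pos Real.pi_pos] at h1
  refine h1.trans ?_
  calc Real.exp (Real.pi * |s.im|) ≤ Real.exp (1 + 2 * (s.im * arg s)) :=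
        Real.exp_le_exp.mpr (by linarith)
    _ ≤ _ := le_mul_of_one_le_left (Real.exp_pos _).le (by linarith [Real.pi_gt_three])

lemma norm_stirlingQuotient_add_one {s : ℂ} (hs : s.re = 1 / 2) :
    ‖stirlingQuotient (s + 1)‖ = ‖stirlingQuotient s‖ *
      (‖s‖ / ‖s + 1‖ * Real.exp (1 + s.im * (arg (s + 1) - arg s))) := by
  have hs0 : 0 < s.re := by rw [hs]; norm_num
  have hne : s ≠ 0 := fun h => by simp [h] at hs0
  rw [norm_stirlingQuotient hs0, norm_stirlingQuotient (by simp; linarith),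
    Gamma_add_one s hne, norm_mul, hs, sub_self, Real.rpow_zero, add_re, one_re, hs, add_im,
    one_im, add_zero, show (1 / 2 - (1 / 2 + 1) : ℝ) = -1 by norm_num, Real.rpow_neg_one]
  have : Real.exp (1 + s.im * (arg (s + 1) - arg s)) * Real.exp (s.im * arg s) =
      Real.exp 1 * Real.exp (s.im * arg (s + 1)) := by
    rw [← Real.exp_add, ← Real.exp_add]; ring_nf
  rw [Real.exp_add]
  linear_combination (-‖s‖ * ‖Gamma s‖ * Real.exp (1 / 2) * ‖s + 1‖⁻¹) * this

/-- Phragmén–Lindelöf, applied to the quotient and to its reciprocal, reduces both bounds to the two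
boundary lines. On Re s = 1/2 the modulus of Γ is explicit, and the functional equation carries the
bounds to Re s = 3/2. -/
lemma exists_bounds_norm_stirlingQuotient :
    ∃ c C : ℝ, 0 < c ∧ 0 < C ∧ ∀ s : ℂ, 1 / 2 ≤ s.re → s.re ≤ 3 / 2 →
      c ≤ ‖stirlingQuotient s‖ ∧ ‖stirlingQuotient s‖ ≤ C := by
  have hbd : ∀ s : ℂ, s.re = 1 / 2 →
      ‖s‖ / ‖s + 1‖ * Real.exp (1 + s.im * (arg (s + 1) - arg s)) ≤ Real.exp 2 ∧
      Real.exp (-2) / 3 ≤ ‖s‖ / ‖s + 1‖ * Real.exp (1 + s.im * (arg (s + 1) - arg s)) := by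
    intro s hs
    have hs0 : 0 < s.re := by rw [hs]; norm_num
    have hs1 : 0 < (s + 1).re := by simp; linarith
    have hn : 1 / 2 ≤ ‖s‖ := hs ▸ re_le_norm s
    have hn1 : 0 < ‖s + 1‖ := norm_pos_iff.mpr fun h => by simp [h] at hs1
    have hle : ‖s‖ ≤ ‖s + 1‖ := by
      rw [← sq_le_sq₀ (norm_nonneg _) (norm_nonneg _), ← normSq_eq_norm_sq, ← normSq_eq_norm_sq,
        normSq_apply, normSq_apply]
      simp
      nlinarith
    have hge : ‖s + 1‖ ≤ 3 * ‖s‖ := by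
      have := norm_add_le s 1
      rw [norm_one] at this
      linarith
    have e1 := im_mul_arg_le hs0
    have e2 := im_mul_arg_le hs1
    have e3 := le_im_mul_arg hs0
    have e4 := le_im_mul_arg hs1
    simp only [add_im, one_im, add_zero, add_re, one_re] at e2 e4
    constructor
    -- By the two-sided estimates for Im s · arg s at s and s + 1, the exponent lies between -1/2
    -- and 3/2; ±2 is a convenient enlargement.
    · calc _ ≤ 1 * Real.exp 2 := by
            gcongr
            · rw [div_le_one hn1]; exact hle
            · linarith
        _ = _ := one_mul _
    · calc Real.exp (-2) / 3 = 1 / 3 * Real.exp (-2) := by ring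
        _ ≤ _ := by
            gcongr ?_ * ?_
            · rw [le_div_iff₀ hn1]; linarith
            · exact Real.exp_le_exp.mpr (by linarith)
  obtain ⟨C₁, hC₁, hG⟩ := exists_norm_Gamma_le (a := 1 / 2) (by norm_num) (3 / 2)
  obtain ⟨C₂, hC₂, hG'⟩ := exists_norm_inv_Gamma_le (1 / 2) (3 / 2)
  have hsub : ∀ s : ℂ, s.re = 3 / 2 → (s - 1).re = 1 / 2 := fun s hs => by simp [hs]; norm_num
  have hup := norm_le_of_norm_le_boundary (f := stirlingQuotient)
    (B := √(2 * Real.pi * Real.exp 1)) (C := √(2 * Real.pi * Real.exp 1) * Real.exp 2)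
    (A := C₁ * (Real.exp (3 / 2) * 2)) (D := Real.pi / 2)
    (fun s hs => differentiableAt_stirlingQuotient hs) ?_
    (fun s hs => norm_stirlingQuotient_half_le hs) ?_
  · have hlow := norm_le_of_norm_le_boundary (f := fun s => (stirlingQuotient s)⁻¹)
      (B := 1) (C := (Real.exp (-2) / 3)⁻¹) (A := C₂ * 4) (D := Real.pi + 1)
      (fun s hs => (differentiableAt_stirlingQuotient hs).inv (stirlingQuotient_ne_zero hs)) ?_
      (fun s hs => ?_) ?_
    · refine ⟨(max 1 (Real.exp (-2) / 3)⁻¹)⁻¹, _, ?_, ?_, fun s h1 h2 => ⟨?_, hup s h1 h2⟩⟩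
      · positivity
      · positivity
      · have h := hlow s h1 h2
        have hpos : 0 < ‖stirlingQuotient s‖ :=
          norm_pos_iff.mpr (stirlingQuotient_ne_zero (by linarith))
        rw [norm_inv] at h
        exact inv_le_of_inv_le₀ hpos h
    · intro s h1 h2
      have hs0 : 0 < s.re := by linarith
      have hn : 1 / 2 ≤ ‖s‖ := h1.trans (re_le_norm s)
      have hnpos : 0 < ‖s‖ := by linarith
      rw [norm_inv, norm_stirlingQuotient hs0, mul_inv, ← norm_inv, mul_inv, mul_inv,
        ← Real.exp_neg, ← Real.exp_neg, ← Real.rpow_neg hnpos.le, neg_sub]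
      have e1 : ‖s‖ ^ (s.re - 1 / 2) ≤ 4 * Real.exp |s.im| := by
        have h3 : ‖s‖ ≤ 3 / 2 + |s.im| := by
          have := norm_le_abs_re_add_abs_im s
          rw [abs_of_pos hs0] at this
          linarith
        calc ‖s‖ ^ (s.re - 1 / 2) ≤ (‖s‖ + 1) ^ (s.re - 1 / 2) :=
              Real.rpow_le_rpow hnpos.le (by linarith) (by linarith)
          _ ≤ (‖s‖ + 1) ^ (1 : ℝ) :=
              Real.rpow_le_rpow_of_exponent_le (by linarith) (by linarith)
          _ ≤ 4 * Real.exp |s.im| := by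
              rw [Real.rpow_one]
              linarith [Real.add_one_le_exp |s.im|, abs_nonneg s.im]
      have e2 : Real.exp (-s.re) ≤ 1 := Real.exp_le_one_iff.mpr (by linarith)
      have e3 : Real.exp (-(s.im * arg s)) ≤ 1 := Real.exp_le_one_iff.mpr (by
        rw [im_mul_arg_eq_abs]; nlinarith [abs_nonneg s.im, abs_nonneg (arg s)])
      calc _ ≤ (C₂ * Real.exp (Real.pi * |s.im|)) * (1 * (4 * Real.exp |s.im|) * 1) := by
            gcongr
            exact hG' s h1 h2
        _ = _ := by rw [add_mul, Real.exp_add]; ring_nf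
    · rw [norm_inv]
      exact inv_le_one_of_one_le₀ (one_le_norm_stirlingQuotient_half hs)
    · intro s hs
      have h1 := norm_stirlingQuotient_add_one (hsub s hs)
      rw [sub_add_cancel] at h1
      have h2 := (hbd _ (hsub s hs)).2
      rw [sub_add_cancel] at h2
      rw [norm_inv, h1]
      refine inv_anti₀ (by positivity) (h2.trans ?_)
      exact le_mul_of_one_le_left (le_trans (by positivity) h2)
        (one_le_norm_stirlingQuotient_half (hsub s hs))
  · intro s h1 h2
    have hs0 : 0 < s.re := by linarith
    have hn : 1 / 2 ≤ ‖s‖ := h1.trans (re_le_norm s)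
    rw [norm_stirlingQuotient hs0]
    have e1 : ‖s‖ ^ (1 / 2 - s.re) ≤ 2 := by
      calc ‖s‖ ^ (1 / 2 - s.re) ≤ (1 / 2 : ℝ) ^ (1 / 2 - s.re) :=
            Real.rpow_le_rpow_of_nonpos (by norm_num) hn (by linarith)
        _ ≤ (1 / 2 : ℝ) ^ (-1 : ℝ) :=
            Real.rpow_le_rpow_of_exponent_ge (by norm_num) (by norm_num) (by linarith)
        _ = 2 := by rw [Real.rpow_neg_one]; norm_num
    have e2 := im_mul_arg_le hs0
    calc _ ≤ C₁ * (Real.exp (3 / 2) * 2 * Real.exp (Real.pi / 2 * |s.im|)) := by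
          gcongr
          exact hG s h1 h2
      _ = _ := by ring
  · intro s hs
    have h1 := norm_stirlingQuotient_add_one (hsub s hs)
    have h2 := (hbd _ (hsub s hs)).1
    rw [sub_add_cancel] at h1 h2
    rw [h1]
    exact mul_le_mul (norm_stirlingQuotient_half_le (hsub s hs)) h2 (by positivity) (by positivity)

end Stirling

/-! ### Exact order of growth of gamma quotients along vertical lines. -/

section VerticalAsymptotics

open Filter Topology Asymptotics

/-- The model function `(1 + |y|) ^ e * exp (d |y|)` for the growth of a gamma quotient along a
vertical line. -/
noncomputable def verticalModel (e d y : ℝ) : ℝ :=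
  (1 + |y|) ^ e * Real.exp (d * |y|)

lemma verticalModel_pos (e d y : ℝ) : 0 < verticalModel e d y := by
  unfold verticalModel; positivity

lemma verticalModel_mul (e d e' d' y : ℝ) :
    verticalModel e d y * verticalModel e' d' y = verticalModel (e + e') (d + d') y := by
  unfold verticalModel
  rw [Real.rpow_add (by positivity), add_mul, Real.exp_add]
  ring

lemma verticalModel_inv (e d y : ℝ) :
    (verticalModel e d y)⁻¹ = verticalModel (-e) (-d) y := by
  unfold verticalModel
  rw [Real.rpow_neg (by positivity), neg_mul, Real.exp_neg, mul_inv]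

lemma verticalModel_neg (e d y : ℝ) : verticalModel e d (-y) = verticalModel e d y := by
  simp [verticalModel]

lemma isTheta_of_bounds {α : Type*} {l : Filter α} {f : α → ℂ} {g : α → ℝ} {c C : ℝ} (hc : 0 < c)
    (hg : ∀ y, 0 < g y) (h : ∀ᶠ y in l, c * g y ≤ ‖f y‖ ∧ ‖f y‖ ≤ C * g y) : f =Θ[l] g := by
  constructor
  · refine IsBigO.of_bound C (h.mono fun y hy => ?_)
    rw [Real.norm_of_nonneg (hg y).le]
    exact hy.2
  · refine IsBigO.of_bound c⁻¹ (h.mono fun y hy => ?_)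
    rw [Real.norm_of_nonneg (hg y).le, ← div_eq_inv_mul, le_div_iff₀ hc, mul_comm]
    exact hy.1

lemma isTheta_one_add_abs_add (v : ℝ) (l : Filter ℝ) :
    (fun y : ℝ => 1 + |y + v|) =Θ[l] fun y => 1 + |y| := by
  have key : ∀ y w : ℝ, 1 + |y + w| ≤ (1 + |w|) * (1 + |y|) := fun y w => by
    nlinarith [abs_add_le y w, abs_nonneg y, abs_nonneg w, mul_nonneg (abs_nonneg y) (abs_nonneg w)]
  constructor
  · refine IsBigO.of_bound (1 + |v|) (Eventually.of_forall fun y => ?_)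
    rw [Real.norm_of_nonneg (by positivity), Real.norm_of_nonneg (by positivity)]
    exact key y v
  · refine IsBigO.of_bound (1 + |v|) (Eventually.of_forall fun y => ?_)
    rw [Real.norm_of_nonneg (by positivity), Real.norm_of_nonneg (by positivity)]
    simpa using key (y + v) (-v)

lemma isTheta_verticalModel_add (e d v : ℝ) (l : Filter ℝ) :
    (fun y : ℝ => verticalModel e d (y + v)) =Θ[l] verticalModel e d := by
  refine IsTheta.mul (IsTheta.rpow (Eventually.of_forall fun y => by positivity)
    (Eventually.of_forall fun y => by positivity) (isTheta_one_add_abs_add v l)) ?_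
  have key : ∀ y w : ℝ,
      Real.exp (d * |y + w|) ≤ Real.exp (|d| * |w|) * Real.exp (d * |y|) := fun y w => by
    rw [← Real.exp_add]
    refine Real.exp_le_exp.mpr ?_
    have h1 : |(|y + w| - |y|)| ≤ |w| := by simpa using abs_abs_sub_abs_le_abs_sub (y + w) y
    have h2 : d * (|y + w| - |y|) ≤ |d| * |w| :=
      (le_abs_self _).trans (by rw [abs_mul]; gcongr)
    linarith
  constructor
  · refine IsBigO.of_bound (Real.exp (|d| * |v|)) (Eventually.of_forall fun y => ?_)
    rw [Real.norm_of_nonneg (by positivity), Real.norm_of_nonneg (by positivity)]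
    exact key y v
  · refine IsBigO.of_bound (Real.exp (|d| * |v|)) (Eventually.of_forall fun y => ?_)
    rw [Real.norm_of_nonneg (by positivity), Real.norm_of_nonneg (by positivity)]
    simpa using key (y + v) (-v)

lemma isTheta_add_mul_I (x : ℝ) :
    (fun y : ℝ => (x : ℂ) + y * I) =Θ[cocompact ℝ] verticalModel 1 0 := by
  have hlarge : ∀ᶠ y : ℝ in cocompact ℝ, 1 ≤ |y| :=
    (tendsto_norm_cocompact_atTop (E := ℝ)).eventually (eventually_ge_atTop 1)
  refine isTheta_of_bounds (c := 1 / 2) (C := 1 + |x|) (by norm_num) (verticalModel_pos 1 0)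
    (hlarge.mono fun y hy => ?_)
  have h1 : |y| ≤ ‖(x : ℂ) + y * I‖ := by simpa using abs_im_le_norm ((x : ℂ) + y * I)
  have h2 : ‖(x : ℂ) + y * I‖ ≤ |x| + |y| := by
    simpa using norm_le_abs_re_add_abs_im ((x : ℂ) + y * I)
  simp only [verticalModel, Real.rpow_one, zero_mul, Real.exp_zero, mul_one]
  constructor
  · linarith
  · nlinarith [abs_nonneg x]

lemma isTheta_Gamma_vertical_of_mem_strip {x : ℝ} (h1 : 1 / 2 ≤ x) (h2 : x ≤ 3 / 2) :
    (fun y : ℝ => Gamma (x + y * I)) =Θ[cocompact ℝ] verticalModel (x - 1 / 2) (-(Real.pi / 2)) := by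
  obtain ⟨c, C, hc, hC, h⟩ := exists_bounds_norm_stirlingQuotient
  have hT : (fun y : ℝ => Gamma (x + y * I)) =Θ[cocompact ℝ] fun y : ℝ =>
      ‖(x : ℂ) + y * I‖ ^ (x - 1 / 2) * Real.exp (-(Real.pi / 2) * |y|) := by
    have hx : 0 < x := by linarith
    have hne : ∀ y : ℝ, (x : ℂ) + y * I ≠ 0 := fun y h0 => by
      have := congrArg re h0
      simp at this
      linarith
    refine isTheta_of_bounds (c := c * Real.exp (-(3 / 2))) (C := C * Real.exp (3 / 2))
      (by positivity)
      (fun y => mul_pos (Real.rpow_pos_of_pos (norm_pos_iff.mpr (hne y)) _) (Real.exp_pos _))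
      (Eventually.of_forall fun y => ?_)
    set s : ℂ := x + y * I with hs
    have hre : s.re = x := by simp [hs]
    have him : s.im = y := by simp [hs]
    have hpos : 0 < ‖s‖ := norm_pos_iff.mpr (hne y)
    have hs0 : 0 < s.re := by rw [hre]; exact hx
    have hb := h s (by rw [hre]; exact h1) (by rw [hre]; exact h2)
    have e1 := im_mul_arg_le hs0
    have e2 := le_im_mul_arg hs0
    have hq : ‖Gamma s‖ = ‖stirlingQuotient s‖ *
        (‖s‖ ^ (x - 1 / 2) * Real.exp (-(x + y * arg s))) := by
      rw [norm_stirlingQuotient hs0, hre, him, Real.exp_neg, Real.exp_add,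
        show x - 1 / 2 = -(1 / 2 - x) by ring, Real.rpow_neg hpos.le]
      have : ‖s‖ ^ (1 / 2 - x) ≠ 0 := (Real.rpow_pos_of_pos hpos _).ne'
      field_simp
    rw [him, hre] at e2
    rw [him] at e1
    have hr : 0 < ‖s‖ ^ (x - 1 / 2) := Real.rpow_pos_of_pos hpos _
    rw [hq]
    constructor
    · calc c * Real.exp (-(3 / 2)) * (‖s‖ ^ (x - 1 / 2) * Real.exp (-(Real.pi / 2) * |y|))
          = c * (‖s‖ ^ (x - 1 / 2) * Real.exp (-(3 / 2) + -(Real.pi / 2) * |y|)) := by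
            rw [Real.exp_add]; ring
        _ ≤ _ := by
            refine mul_le_mul hb.1 ?_ (by positivity) (norm_nonneg _)
            refine mul_le_mul_of_nonneg_left (Real.exp_le_exp.mpr (by linarith)) hr.le
    · calc ‖stirlingQuotient s‖ * (‖s‖ ^ (x - 1 / 2) * Real.exp (-(x + y * arg s)))
          ≤ C * (‖s‖ ^ (x - 1 / 2) * Real.exp (3 / 2 + -(Real.pi / 2) * |y|)) := by
            refine mul_le_mul hb.2 ?_ (by positivity) hC.le
            refine mul_le_mul_of_nonneg_left (Real.exp_le_exp.mpr (by linarith)) hr.le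
        _ = _ := by rw [Real.exp_add]; ring
  refine hT.trans (IsTheta.mul ?_ isTheta_rfl)
  refine IsTheta.rpow (Eventually.of_forall fun y => norm_nonneg _)
    (Eventually.of_forall fun y => by positivity) ?_
  refine (isTheta_norm_left.mpr (isTheta_add_mul_I x)).trans (EventuallyEq.isTheta ?_)
  exact Eventually.of_forall fun y => by simp [verticalModel]

/-- Γ(s+1) = sΓ(s) changes the exponent by exactly the order of s. The equivalence is used in both
directions to reach every abscissa from the strip. -/
lemma isTheta_Gamma_vertical_add_one_iff (x : ℝ) :
    (fun y : ℝ => Gamma ((x + 1 : ℝ) + y * I)) =Θ[cocompact ℝ]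
        verticalModel (x + 1 - 1 / 2) (-(Real.pi / 2)) ↔
      (fun y : ℝ => Gamma (x + y * I)) =Θ[cocompact ℝ]
        verticalModel (x - 1 / 2) (-(Real.pi / 2)) := by
  have hlarge : ∀ᶠ y : ℝ in cocompact ℝ, 1 ≤ |y| :=
    (tendsto_norm_cocompact_atTop (E := ℝ)).eventually (eventually_ge_atTop 1)
  have hne : ∀ᶠ y : ℝ in cocompact ℝ, (x : ℂ) + y * I ≠ 0 := hlarge.mono fun y hy h0 => by
    have := congrArg im h0
    simp at this
    norm_num [this] at hy
  have hrec : (fun y : ℝ => Gamma ((x + 1 : ℝ) + y * I)) =ᶠ[cocompact ℝ]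
      fun y : ℝ => ((x : ℂ) + y * I) * Gamma (x + y * I) := hne.mono fun y hy => by
    refine Eq.trans ?_ (Gamma_add_one _ hy)
    push_cast
    ring_nf
  have hmod : verticalModel (x + 1 - 1 / 2) (-(Real.pi / 2)) =
      fun y => verticalModel 1 0 y * verticalModel (x - 1 / 2) (-(Real.pi / 2)) y := by
    ext y
    rw [verticalModel_mul]
    ring_nf
  rw [hmod]
  constructor
  · intro h
    have h1 := (isTheta_add_mul_I x).inv.mul (hrec.symm.trans_isTheta h)
    refine (EventuallyEq.trans_isTheta ?_ h1).trans_eventuallyEq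
      (Eventually.of_forall fun y => ?_)
    · exact hne.mono fun y hy => (inv_mul_cancel_left₀ hy _).symm
    · exact inv_mul_cancel_left₀ (verticalModel_pos 1 0 y).ne' _
  · intro h
    exact hrec.trans_isTheta ((isTheta_add_mul_I x).mul h)

/-- The growth of the Gamma function along vertical lines, by the formula of Stirling. -/
theorem isTheta_Gamma_vertical (x : ℝ) :
    (fun y : ℝ => Gamma (x + y * I)) =Θ[cocompact ℝ]
      verticalModel (x - 1 / 2) (-(Real.pi / 2)) := by
  -- The assertion itself, as a function of x with values in `Prop`, has period 1, so x may be taken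
  -- in [1/2, 3/2).
  have hper : Function.Periodic (fun x : ℝ => (fun y : ℝ => Gamma (x + y * I)) =Θ[cocompact ℝ]
      verticalModel (x - 1 / 2) (-(Real.pi / 2))) 1 := fun x =>
    propext (isTheta_Gamma_vertical_add_one_iff x)
  obtain ⟨x', hx', h⟩ := hper.exists_mem_Ico one_pos x (1 / 2)
  exact h.mpr (isTheta_Gamma_vertical_of_mem_strip hx'.1 (by linarith [hx'.2]))

lemma isTheta_Gamma_add_vertical (u : ℂ) :
    (fun y : ℝ => Gamma (u + y * I)) =Θ[cocompact ℝ]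
      verticalModel (u.re - 1 / 2) (-(Real.pi / 2)) := by
  have hT : Tendsto (fun y : ℝ => y + u.im) (cocompact ℝ) (cocompact ℝ) :=
    (Homeomorph.addRight u.im).isClosedEmbedding.tendsto_cocompact
  have h1 : (fun y : ℝ => Gamma (u.re + (y + u.im : ℝ) * I)) =Θ[cocompact ℝ]
      fun y : ℝ => verticalModel (u.re - 1 / 2) (-(Real.pi / 2)) (y + u.im) :=
    ⟨(isTheta_Gamma_vertical u.re).1.comp_tendsto hT,
      (isTheta_Gamma_vertical u.re).2.comp_tendsto hT⟩
  refine (EventuallyEq.trans_isTheta (Eventually.of_forall fun y => ?_) h1).trans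
    (isTheta_verticalModel_add _ _ _ _)
  refine congrArg Gamma ?_
  conv_lhs => rw [← re_add_im u]
  push_cast
  ring

lemma isTheta_Gamma_sub_vertical (u : ℂ) :
    (fun y : ℝ => Gamma (u - y * I)) =Θ[cocompact ℝ]
      verticalModel (u.re - 1 / 2) (-(Real.pi / 2)) := by
  have hT : Tendsto (fun y : ℝ => -y) (cocompact ℝ) (cocompact ℝ) :=
    (Homeomorph.neg ℝ).isClosedEmbedding.tendsto_cocompact
  have h1 : (fun y : ℝ => Gamma (u + (-y : ℝ) * I)) =Θ[cocompact ℝ]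
      fun y : ℝ => verticalModel (u.re - 1 / 2) (-(Real.pi / 2)) (-y) :=
    ⟨(isTheta_Gamma_add_vertical u).1.comp_tendsto hT,
      (isTheta_Gamma_add_vertical u).2.comp_tendsto hT⟩
  refine (EventuallyEq.trans_isTheta (Eventually.of_forall fun y => ?_) h1).trans_eventuallyEq
    (Eventually.of_forall fun y => verticalModel_neg _ _ _)
  refine congrArg Gamma ?_
  push_cast
  ring

lemma isTheta_prod_Gamma_add (l : List ℂ) (γ : ℝ) :
    (fun y : ℝ => (l.map fun b => Gamma (b + (γ + y * I))).prod) =Θ[cocompact ℝ]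
      verticalModel (l.sum.re + l.length * (γ - 1 / 2)) (-(Real.pi / 2) * l.length) := by
  induction l with
  | nil =>
    refine EventuallyEq.trans_isTheta (f₂ := fun _ => 1)
      (Eventually.of_forall fun y => by simp) ?_
    refine IsTheta.of_norm_eventuallyEq (Eventually.of_forall fun y => by simp [verticalModel])
  | cons b l ih =>
    have h := (isTheta_Gamma_add_vertical (b + γ)).mul ih
    refine (EventuallyEq.trans_isTheta (Eventually.of_forall fun y => ?_) h).trans_eventuallyEq
      (Eventually.of_forall fun y => ?_)
    · simp only [List.map_cons, List.prod_cons, add_assoc]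
    · simp only
      rw [verticalModel_mul]
      congr 1
      · simp; ring
      · simp; ring

lemma isTheta_prod_Gamma_sub (l : List ℂ) (γ : ℝ) :
    (fun y : ℝ => (l.map fun a => Gamma (1 - a - (γ + y * I))).prod) =Θ[cocompact ℝ]
      verticalModel (-l.sum.re + l.length * (1 / 2 - γ)) (-(Real.pi / 2) * l.length) := by
  induction l with
  | nil =>
    refine EventuallyEq.trans_isTheta (f₂ := fun _ => 1)
      (Eventually.of_forall fun y => by simp) ?_
    refine IsTheta.of_norm_eventuallyEq (Eventually.of_forall fun y => by simp [verticalModel])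
  | cons a l ih =>
    have h := (isTheta_Gamma_sub_vertical (1 - a - γ)).mul ih
    refine (EventuallyEq.trans_isTheta (Eventually.of_forall fun y => ?_) h).trans_eventuallyEq
      (Eventually.of_forall fun y => ?_)
    · simp only [List.map_cons, List.prod_cons, sub_sub, add_assoc]
    · simp only
      rw [verticalModel_mul]
      congr 1
      · simp; ring
      · simp; ring

/-- The growth of the gamma quotient of the Meijer G-function along vertical lines. -/
theorem isTheta_meijerKernel_vertical (a₁ a₂ b₁ b₂ : List ℂ) (γ : ℝ) :
    (fun y : ℝ => meijerKernel a₁ a₂ b₁ b₂ (γ + y * I)) =Θ[cocompact ℝ]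
      verticalModel ((((b₁ ++ b₂).length : ℝ) - (a₁ ++ a₂).length) * γ +
        (meijerMu a₁ a₂ b₁ b₂).re - 1) (-(Real.pi * meijerC a₁ a₂ b₁ b₂)) := by
  -- The four products combine to the power (q-p)(γ-1/2) + Re(∑b - ∑a) = (q-p)γ + Re μ - 1. The
  -- numerator has 2c more factors than the denominator, each contributing -π/2 to the exponential
  -- rate.
  have h := ((isTheta_prod_Gamma_add b₁ γ).mul (isTheta_prod_Gamma_sub a₁ γ)).div
    ((isTheta_prod_Gamma_add a₂ γ).mul (isTheta_prod_Gamma_sub b₂ γ))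
  refine h.trans_eventuallyEq (Eventually.of_forall fun y => ?_)
  simp only
  rw [verticalModel_mul, verticalModel_mul, div_eq_mul_inv, verticalModel_inv, verticalModel_mul]
  congr 1
  · simp [meijerMu, List.sum_append]
    ring
  · simp [meijerC]
    ring

end VerticalAsymptotics

/-! ### Contour independence and convergence of the Mellin–Barnes integrals. -/

section Kernels

open Filter Topology Asymptotics

lemma differentiableAt_list_prod_map {ι : Type*} {l : List ι} {f : ι → ℂ → ℂ} {s : ℂ}
    (h : ∀ i ∈ l, DifferentiableAt ℂ (f i) s) :
    DifferentiableAt ℂ (fun s => (l.map fun i => f i s).prod) s := by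
  induction l with
  | nil => simp
  | cons i l ih =>
    simp only [List.map_cons, List.prod_cons]
    exact (h i (by simp)).mul (ih fun j hj => h j (by simp [hj]))

/-- `f` is of at most exponential growth in the strip between `Re s = σ` and `Re s = τ`. -/
def ExpGrowthOnStrip (σ τ : ℝ) (f : ℂ → ℂ) : Prop :=
  ∃ C D : ℝ, ∀ s : ℂ, s.re ∈ Set.uIcc σ τ → ‖f s‖ ≤ C * Real.exp (D * |s.im|)

lemma ExpGrowthOnStrip.mul {σ τ : ℝ} {f g : ℂ → ℂ} (hf : ExpGrowthOnStrip σ τ f)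
    (hg : ExpGrowthOnStrip σ τ g) : ExpGrowthOnStrip σ τ fun s => f s * g s := by
  obtain ⟨C, D, h⟩ := hf
  obtain ⟨C', D', h'⟩ := hg
  refine ⟨C * C', D + D', fun s hs => ?_⟩
  rw [norm_mul]
  calc ‖f s‖ * ‖g s‖ ≤ (C * Real.exp (D * |s.im|)) * (C' * Real.exp (D' * |s.im|)) :=
        mul_le_mul (h s hs) (h' s hs) (norm_nonneg _) ((norm_nonneg _).trans (h s hs))
    _ = _ := by rw [add_mul, Real.exp_add]; ring

lemma ExpGrowthOnStrip.list_prod {ι : Type*} {σ τ : ℝ} {l : List ι} {f : ι → ℂ → ℂ}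
    (h : ∀ i ∈ l, ExpGrowthOnStrip σ τ (f i)) :
    ExpGrowthOnStrip σ τ fun s => (l.map fun i => f i s).prod := by
  induction l with
  | nil => exact ⟨1, 0, fun s _ => by simp⟩
  | cons i l ih =>
    simp only [List.map_cons, List.prod_cons]
    exact (h i (by simp)).mul (ih fun j hj => h j (by simp [hj]))

lemma add_mul_mem_uIcc {σ τ x : ℝ} (u B : ℝ) (hx : x ∈ Set.uIcc σ τ) :
    u + B * x ∈ Set.uIcc (u + B * σ) (u + B * τ) := by
  rw [Set.mem_uIcc] at hx ⊢
  rcases le_total 0 B with hB | hB <;> rcases hx with ⟨h1, h2⟩ | ⟨h1, h2⟩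
  · left; constructor <;> nlinarith
  · right; constructor <;> nlinarith
  · right; constructor <;> nlinarith
  · left; constructor <;> nlinarith

lemma add_mul_pos_of_mem_uIcc {σ τ x u B : ℝ} (h1 : 0 < u + B * σ) (h2 : 0 < u + B * τ)
    (hx : x ∈ Set.uIcc σ τ) : 0 < u + B * x :=
  (lt_min h1 h2).trans_le (add_mul_mem_uIcc u B hx).1

lemma re_add_ofReal_mul (u s : ℂ) (B : ℝ) : (u + B * s).re = u.re + B * s.re := by
  rw [add_re, re_ofReal_mul]

lemma expGrowthOnStrip_Gamma {σ τ : ℝ} (u : ℂ) (B : ℝ) (h1 : 0 < u.re + B * σ)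
    (h2 : 0 < u.re + B * τ) : ExpGrowthOnStrip σ τ fun s => Gamma (u + B * s) := by
  obtain ⟨C, -, h⟩ := exists_norm_Gamma_le (lt_min h1 h2) (max (u.re + B * σ) (u.re + B * τ))
  refine ⟨C, 0, fun s hs => ?_⟩
  have hm := add_mul_mem_uIcc u.re B hs
  rw [← re_add_ofReal_mul] at hm
  simpa using h (u + B * s) hm.1 hm.2

lemma expGrowthOnStrip_inv_Gamma (σ τ : ℝ) (u : ℂ) (B : ℝ) :
    ExpGrowthOnStrip σ τ fun s => (Gamma (u + B * s))⁻¹ := by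
  obtain ⟨C, hC, h⟩ := exists_norm_inv_Gamma_le (min (u.re + B * σ) (u.re + B * τ))
    (max (u.re + B * σ) (u.re + B * τ))
  refine ⟨C * Real.exp (Real.pi * |u.im|), Real.pi * |B|, fun s hs => ?_⟩
  have hm := add_mul_mem_uIcc u.re B hs
  rw [← re_add_ofReal_mul] at hm
  refine (h (u + B * s) hm.1 hm.2).trans ?_
  rw [mul_assoc, ← Real.exp_add]
  refine mul_le_mul_of_nonneg_left (Real.exp_le_exp.mpr ?_) hC.le
  have h3 : |(u + B * s).im| ≤ |u.im| + |B| * |s.im| := by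
    rw [add_im, im_ofReal_mul, ← abs_mul]
    exact abs_add_le _ _
  nlinarith [Real.pi_pos]

lemma expGrowthOnStrip_exp (σ τ : ℝ) (k : ℂ) : ExpGrowthOnStrip σ τ fun s => cexp (k * s) := by
  refine ⟨Real.exp (‖k‖ * max |σ| |τ|), ‖k‖, fun s hs => ?_⟩
  rw [norm_exp, ← Real.exp_add]
  refine Real.exp_le_exp.mpr ((re_le_norm _).trans ?_)
  rw [norm_mul, ← mul_add]
  refine mul_le_mul_of_nonneg_left ((norm_le_abs_re_add_abs_im s).trans ?_) (norm_nonneg k)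
  gcongr
  rcases Set.mem_uIcc.mp hs with h | h
  · exact abs_le_max_abs_abs h.1 h.2
  · rw [max_comm]; exact abs_le_max_abs_abs h.1 h.2

/-- Every factor becomes Γ(u + Bs) or its reciprocal, with B of either sign, so one estimate for
each kind suffices. Where a denominator factor has a pole, the conventions Γ = 0 and 1/0 = 0 give
the correct value 0 of 1/Γ. -/
lemma foxKernel_eq (a₁ a₂ b₁ b₂ : List (ℂ × ℝ)) (s : ℂ) :
    foxKernel a₁ a₂ b₁ b₂ s =
      ((b₁.map fun b => Gamma (b.1 + b.2 * s)).prod *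
        (a₁.map fun a => Gamma (1 - a.1 + (-a.2 : ℝ) * s)).prod) *
      ((a₂.map fun a => (Gamma (a.1 + a.2 * s))⁻¹).prod *
        (b₂.map fun b => (Gamma (1 - b.1 + (-b.2 : ℝ) * s))⁻¹).prod) := by
  rw [foxKernel, div_eq_mul_inv, mul_inv, List.prod_inv, List.prod_inv, List.map_map, List.map_map]
  simp [Function.comp_def, sub_eq_add_neg]

lemma meijerKernel_eq_foxKernel (a₁ a₂ b₁ b₂ : List ℂ) :
    meijerKernel a₁ a₂ b₁ b₂ =
      foxKernel (withOne a₁) (withOne a₂) (withOne b₁) (withOne b₂) := by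
  ext s
  simp [meijerKernel, foxKernel, withOne, Function.comp_def]

lemma differentiableAt_Gamma_add_mul {u : ℂ} {B : ℝ} {s : ℂ} (h : 0 < u.re + B * s.re) :
    DifferentiableAt ℂ (fun s => Gamma (u + B * s)) s := by
  have h1 : ∀ m : ℕ, u + B * s ≠ -m := fun m h0 => by
    have h2 := congrArg re h0
    rw [re_add_ofReal_mul] at h2
    have h3 : (0 : ℝ) ≤ m := Nat.cast_nonneg m
    simp at h2
    linarith
  exact (differentiableAt_Gamma _ h1).comp s (f := fun s : ℂ => u + B * s) (by fun_prop)

lemma differentiableAt_foxKernel {a₁ a₂ b₁ b₂ : List (ℂ × ℝ)} {s : ℂ}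
    (hl : ∀ b ∈ b₁, 0 < b.1.re + b.2 * s.re) (hr : ∀ a ∈ a₁, 0 < 1 - a.1.re - a.2 * s.re) :
    DifferentiableAt ℂ (foxKernel a₁ a₂ b₁ b₂) s := by
  have hinv : ∀ (u : ℂ) (B : ℝ), DifferentiableAt ℂ (fun s => (Gamma (u + B * s))⁻¹) s :=
    fun u B => (differentiable_one_div_Gamma _).comp s (f := fun s : ℂ => u + B * s) (by fun_prop)
  rw [funext (foxKernel_eq a₁ a₂ b₁ b₂)]
  refine DifferentiableAt.mul (DifferentiableAt.mul ?_ ?_) (DifferentiableAt.mul ?_ ?_) <;>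
    refine differentiableAt_list_prod_map fun i hi => ?_
  · exact differentiableAt_Gamma_add_mul (hl i hi)
  · refine differentiableAt_Gamma_add_mul ?_
    have := hr i hi
    simp only [sub_re, one_re]
    linarith
  · exact hinv _ _
  · exact hinv _ _

lemma expGrowthOnStrip_foxKernel {a₁ a₂ b₁ b₂ : List (ℂ × ℝ)} {σ τ : ℝ}
    (hl : ∀ b ∈ b₁, 0 < b.1.re + b.2 * σ) (hr : ∀ a ∈ a₁, 0 < 1 - a.1.re - a.2 * σ)
    (hl' : ∀ b ∈ b₁, 0 < b.1.re + b.2 * τ) (hr' : ∀ a ∈ a₁, 0 < 1 - a.1.re - a.2 * τ) :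
    ExpGrowthOnStrip σ τ (foxKernel a₁ a₂ b₁ b₂) := by
  rw [funext (foxKernel_eq a₁ a₂ b₁ b₂)]
  refine ExpGrowthOnStrip.mul (ExpGrowthOnStrip.mul ?_ ?_) (ExpGrowthOnStrip.mul ?_ ?_) <;>
    refine ExpGrowthOnStrip.list_prod fun i hi => ?_
  · exact expGrowthOnStrip_Gamma _ _ (hl i hi) (hl' i hi)
  · have := hr i hi
    have := hr' i hi
    refine expGrowthOnStrip_Gamma _ _ ?_ ?_ <;> (simp only [sub_re, one_re]; linarith)
  · exact expGrowthOnStrip_inv_Gamma _ _ _ _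
  · exact expGrowthOnStrip_inv_Gamma _ _ _ _

/-- A Mellin–Barnes integral takes the same value along any two vertical contours. -/
lemma lineIntegral_foxKernel_mul_exp_eq {a₁ a₂ b₁ b₂ : List (ℂ × ℝ)} {k : ℂ} {σ τ : ℝ}
    (hl : ∀ b ∈ b₁, 0 < b.1.re + b.2 * σ) (hr : ∀ a ∈ a₁, 0 < 1 - a.1.re - a.2 * σ)
    (hl' : ∀ b ∈ b₁, 0 < b.1.re + b.2 * τ) (hr' : ∀ a ∈ a₁, 0 < 1 - a.1.re - a.2 * τ)
    (h : VerticalIntegrable (fun s => foxKernel a₁ a₂ b₁ b₂ s * cexp (k * s)) σ)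
    (h' : VerticalIntegrable (fun s => foxKernel a₁ a₂ b₁ b₂ s * cexp (k * s)) τ) :
    lineIntegral (fun s => foxKernel a₁ a₂ b₁ b₂ s * cexp (k * s)) σ =
      lineIntegral (fun s => foxKernel a₁ a₂ b₁ b₂ s * cexp (k * s)) τ := by
  obtain ⟨C, D, hCD⟩ := (expGrowthOnStrip_foxKernel (a₂ := a₂) (b₂ := b₂) hl hr hl' hr').mul
    (expGrowthOnStrip_exp σ τ k)
  have := integral_vertical_eq (fun s hs => ?_) hCD h h'
  · simp only [lineIntegral]
    rw [integral_mul_const, integral_mul_const, this]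
  · refine DifferentiableAt.mul (differentiableAt_foxKernel (fun b hb => ?_) fun a ha => ?_)
      (by fun_prop)
    · exact add_mul_pos_of_mem_uIcc (hl b hb) (hl' b hb) hs
    · have h1 := hr a ha
      have h2 := hr' a ha
      have := add_mul_pos_of_mem_uIcc (u := 1 - a.1.re) (B := -a.2) (by linarith) (by linarith) hs
      linarith

lemma foxIntegrand_eq_mul_exp (a₁ a₂ b₁ b₂ : List (ℂ × ℝ)) {z : ℂ} (hz : z ≠ 0) :
    foxIntegrand a₁ a₂ b₁ b₂ z = fun s => foxKernel a₁ a₂ b₁ b₂ s * cexp (-log z * s) := by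
  ext s
  rw [foxIntegrand, cpow_def_of_ne_zero hz]
  congr 2
  ring

/-- With `foxIntegrand_eq_mul_exp`, this brings both kinds of integrand to the form of a Fox kernel
times exp(ks), covered by a single contour-independence lemma. -/
lemma meijerIntegrand_eq_mul_exp (a₁ a₂ b₁ b₂ : List ℂ) {z : ℂ} (hz : z ≠ 0) (r : ℝ) :
    meijerIntegrand a₁ a₂ b₁ b₂ z r = fun s =>
      foxKernel (withOne a₁) (withOne a₂) (withOne b₁) (withOne b₂) s *
        cexp (-log z / r * s) := by
  ext s
  rw [meijerIntegrand, cpow_def_of_ne_zero hz, meijerKernel_eq_foxKernel]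
  congr 2
  ring

theorem foxH_eq_lineIntegral {a₁ a₂ b₁ b₂ : List (ℂ × ℝ)} {z : ℂ} (hz : z ≠ 0) {γ : ℝ}
    (h : IsFoxContour a₁ a₂ b₁ b₂ z γ) :
    foxH a₁ a₂ b₁ b₂ z = lineIntegral (foxIntegrand a₁ a₂ b₁ b₂ z) γ := by
  have hex : ∃ γ, IsFoxContour a₁ a₂ b₁ b₂ z γ := ⟨γ, h⟩
  rw [foxH, dif_pos hex]
  have h1 := hex.choose_spec.integrable
  have h2 := h.integrable
  rw [foxIntegrand_eq_mul_exp a₁ a₂ b₁ b₂ hz] at h1 h2 ⊢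
  exact lineIntegral_foxKernel_mul_exp_eq hex.choose_spec.left hex.choose_spec.right h.left h.right
    h1 h2

lemma forall_mem_withOne {l : List ℂ} {p : ℂ × ℝ → Prop} (h : ∀ c ∈ l, p (c, 1)) :
    ∀ c ∈ withOne l, p c := by
  intro c hc
  obtain ⟨c', hc', rfl⟩ := List.mem_map.mp hc
  exact h c' hc'

theorem meijerGr_eq_lineIntegral {a₁ a₂ b₁ b₂ : List ℂ} {z : ℂ} (hz : z ≠ 0) {r γ : ℝ}
    (h : IsMeijerContour a₁ a₂ b₁ b₂ z r γ) :
    meijerGr a₁ a₂ b₁ b₂ z r = lineIntegral (meijerIntegrand a₁ a₂ b₁ b₂ z r) γ := by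
  have hex : ∃ γ, IsMeijerContour a₁ a₂ b₁ b₂ z r γ := ⟨γ, h⟩
  rw [meijerGr, dif_pos hex]
  have h1 := hex.choose_spec.integrable
  have h2 := h.integrable
  rw [meijerIntegrand_eq_mul_exp a₁ a₂ b₁ b₂ hz] at h1 h2 ⊢
  refine lineIntegral_foxKernel_mul_exp_eq ?_ ?_ ?_ ?_ h1 h2 <;>
    refine forall_mem_withOne fun c hc => ?_
  · simpa using hex.choose_spec.left c hc
  · simpa using hex.choose_spec.right c hc
  · simpa using h.left c hc
  · simpa using h.right c hc

lemma integrable_of_isBigO_verticalModel {f : ℝ → ℂ} (hf : Continuous f) {e d : ℝ}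
    (h : f =O[cocompact ℝ] verticalModel e d) (hed : d < 0 ∨ d = 0 ∧ e < -1) : Integrable f := by
  have hint : ∀ {ρ : ℝ}, ρ < -1 → IntegrableAtFilter (verticalModel ρ 0) (cocompact ℝ) := by
    intro ρ hρ
    have h1 := integrable_one_add_norm (E := ℝ) (μ := volume) (r := -ρ) (by simp; linarith)
    refine (h1.congr (Eventually.of_forall fun y => ?_)).integrableAtFilter _
    simp [verticalModel]
  rcases hed with hd | ⟨rfl, he⟩
  · refine hf.locallyIntegrable.integrable_of_isBigO_cocompact (h.trans ?_)
      (hint (show (-2 : ℝ) < -1 by norm_num))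
    have hT : Tendsto (fun y : ℝ => 1 + |y|) (cocompact ℝ) atTop :=
      tendsto_atTop_add_const_left _ _ (tendsto_norm_cocompact_atTop (E := ℝ))
    -- Exponential decay absorbs the power e + 2 and leaves the integrable factor (1+|y|)^(-2).
    have h1 := ((tendsto_rpow_mul_exp_neg_mul_atTop_nhds_zero (e + 2) (-d)
      (by linarith)).comp hT).isBigO_one ℝ
    have h2 : verticalModel e d = fun y => Real.exp (-d) *
        (((fun x : ℝ => x ^ (e + 2) * Real.exp (- -d * x)) ∘ fun y : ℝ => 1 + |y|) y *
          verticalModel (-2) 0 y) := by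
      ext y
      simp only [verticalModel, Function.comp_apply, zero_mul, Real.exp_zero, mul_one, neg_neg]
      have h3 : (1 + |y|) ^ e = (1 + |y|) ^ (e + 2) * (1 + |y|) ^ (-2 : ℝ) := by
        rw [← Real.rpow_add (by positivity)]
        ring_nf
      have h4 : Real.exp (d * |y|) = Real.exp (-d) * Real.exp (d * (1 + |y|)) := by
        rw [← Real.exp_add]
        ring_nf
      rw [h3, h4]
      ring
    rw [h2]
    refine IsBigO.const_mul_left ?_ _
    simpa using h1.mul (isBigO_refl (verticalModel (-2) 0) (cocompact ℝ))
  · exact hf.locallyIntegrable.integrable_of_isBigO_cocompact h (hint he)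

/-- The explicit conditions of convergence imply that the Mellin–Barnes integral converges
absolutely. -/
theorem MeijerConvergence.isMeijerContour {a₁ a₂ b₁ b₂ : List ℂ} {z : ℂ} {r γ : ℝ} (hz : z ≠ 0)
    (hr : r ≠ 0) (hleft : ∀ b ∈ b₁, -b.re < γ) (hright : ∀ a ∈ a₁, γ < 1 - a.re)
    (h : MeijerConvergence a₁ a₂ b₁ b₂ z r γ) : IsMeijerContour a₁ a₂ b₁ b₂ z r γ := by
  have hl : ∀ b ∈ b₁, 0 < b.re + γ := fun b hb => by linarith [hleft b hb]
  have hr' : ∀ a ∈ a₁, 0 < 1 - a.re - γ := fun a ha => by linarith [hright a ha]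
  refine ⟨hl, hr', ?_⟩
  have hcont : Continuous fun y : ℝ => meijerIntegrand a₁ a₂ b₁ b₂ z r (γ + y * I) := by
    rw [meijerIntegrand_eq_mul_exp a₁ a₂ b₁ b₂ hz]
    refine continuous_iff_continuousAt.mpr fun y => ?_
    have hd : DifferentiableAt ℂ (fun s =>
        foxKernel (withOne a₁) (withOne a₂) (withOne b₁) (withOne b₂) s *
          cexp (-log z / r * s)) (γ + y * I) := by
      refine DifferentiableAt.mul (differentiableAt_foxKernel ?_ ?_) (by fun_prop) <;>
        refine forall_mem_withOne fun c hc => ?_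
      · simpa using hl c hc
      · simpa using hr' c hc
    exact ContinuousAt.comp (f := fun y : ℝ => (γ : ℂ) + y * I) hd.continuousAt (by fun_prop)
  have hpow : (fun y : ℝ => z ^ (-(γ + y * I) / (r : ℂ))) =O[cocompact ℝ]
      verticalModel 0 (|z.arg| / |r|) := by
    refine IsBigO.of_bound (‖z‖ ^ (-γ / r)) (Eventually.of_forall fun y => ?_)
    rw [norm_cpow_of_ne_zero hz, Real.norm_of_nonneg (verticalModel_pos _ _ _).le, verticalModel,
      Real.rpow_zero, one_mul, div_eq_mul_inv, ← Real.exp_neg]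
    have h1 : (-(γ + y * I) / (r : ℂ)).re = -γ / r := by simp
    have h2 : (-(γ + y * I) / (r : ℂ)).im = -y / r := by simp
    rw [h1, h2]
    refine mul_le_mul_of_nonneg_left (Real.exp_le_exp.mpr ?_) (by positivity)
    refine (le_abs_self _).trans (le_of_eq ?_)
    rw [abs_neg, abs_mul, abs_div, abs_neg]
    ring
  have hO : (fun y : ℝ => meijerIntegrand a₁ a₂ b₁ b₂ z r (γ + y * I)) =O[cocompact ℝ]
      verticalModel ((((b₁ ++ b₂).length : ℝ) - (a₁ ++ a₂).length) * γ +
        (meijerMu a₁ a₂ b₁ b₂).re - 1 + 0)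
        (-(Real.pi * meijerC a₁ a₂ b₁ b₂) + |z.arg| / |r|) := by
    refine ((isTheta_meijerKernel_vertical a₁ a₂ b₁ b₂ γ).1.mul hpow).congr_right fun y => ?_
    rw [verticalModel_mul]
  refine integrable_of_isBigO_verticalModel hcont hO ?_
  have hrpos : 0 < |r| := abs_pos.mpr hr
  rcases h with ⟨_, harg⟩ | ⟨hc, harg, hμ⟩
  · left
    have : |z.arg| / |r| < meijerC a₁ a₂ b₁ b₂ * Real.pi := by
      rw [div_lt_iff₀ hrpos]
      linarith
    linarith
  · right
    rw [hc, harg]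
    constructor
    · simp
    · linarith

end Kernels

/-! ### The Riemann–Liouville integral as a Mellin–Barnes integral. -/

section RiemannLiouville

open Filter Topology

/-- A nonnegative factor causes no branch correction. The case t = 0 is needed at the endpoint τ =
z, where 1 - t vanishes. -/
lemma ofReal_mul_cpow {t : ℝ} (ht : 0 ≤ t) {z : ℂ} (hz : z ≠ 0) (c : ℂ) :
    ((t : ℂ) * z) ^ c = (t : ℂ) ^ c * z ^ c := by
  rcases ht.eq_or_lt with rfl | ht
  · rcases eq_or_ne c 0 with rfl | hc
    · simp
    · simp [zero_cpow hc]
  · have ht' : (t : ℂ) ≠ 0 := ofReal_ne_zero.mpr ht.ne'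
    rw [cpow_def_of_ne_zero (mul_ne_zero ht' hz), cpow_def_of_ne_zero ht', cpow_def_of_ne_zero hz,
      log_ofReal_mul ht hz, add_mul, exp_add, ofReal_log ht.le]

lemma lineIntegral_eq (F : ℂ → ℂ) (γ : ℝ) :
    lineIntegral F γ = 1 / (2 * (Real.pi : ℂ)) * ∫ y : ℝ, F (γ + y * I) := by
  rw [lineIntegral, integral_mul_const]
  have : (Real.pi : ℂ) ≠ 0 := ofReal_ne_zero.mpr Real.pi_ne_zero
  field_simp

lemma mul_ofReal_mul_cpow {w z : ℂ} (hz : z ≠ 0) (g : ℝ) {t : ℝ} (ht : 0 < t) :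
    w * ((t : ℂ) * z) ^ (g : ℂ) = ((t ^ g : ℝ) : ℂ) * (w * z ^ (g : ℂ)) := by
  rw [ofReal_mul_cpow ht.le hz, ofReal_cpow ht.le]
  ring

lemma meijerIntegrand_ofReal_mul (a₁ a₂ b₁ b₂ : List ℂ) {x : ℂ} (hx : x ≠ 0) (g r : ℝ) {t : ℝ}
    (ht : 0 < t) (s : ℂ) :
    meijerIntegrand a₁ a₂ b₁ b₂ (((t ^ g : ℝ) : ℂ) * x) r s =
      meijerIntegrand a₁ a₂ b₁ b₂ x r s * (t : ℂ) ^ (-((g / r : ℝ) * s)) := by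
  have htg : 0 < t ^ g := Real.rpow_pos_of_pos ht g
  rw [meijerIntegrand, meijerIntegrand, ofReal_mul_cpow htg.le hx,
    cpow_def_of_ne_zero (ofReal_ne_zero.mpr htg.ne'), cpow_def_of_ne_zero (ofReal_ne_zero.mpr ht.ne'),
    ← ofReal_log htg.le, ← ofReal_log ht.le, Real.log_rpow ht]
  push_cast
  rw [show (g : ℂ) * (Real.log t : ℂ) * (-s / r) = (Real.log t : ℂ) * -(g / r * s) by ring]
  ring

/-- The conditions see the argument of x only, so one abscissa γ serves for all points of the
segment. -/
lemma MeijerConvergence.ofReal_mul {a₁ a₂ b₁ b₂ : List ℂ} {x : ℂ} {r γ ρ : ℝ} (hρ : 0 < ρ)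
    (h : MeijerConvergence a₁ a₂ b₁ b₂ x r γ) :
    MeijerConvergence a₁ a₂ b₁ b₂ (ρ * x) r γ := by
  unfold MeijerConvergence at h ⊢
  rwa [arg_real_mul x hρ]

lemma integral_Ioc_cpow_mul_one_sub_cpow {u v : ℂ} (hu : 0 < u.re) (hv : 0 < v.re) :
    ∫ t : ℝ in Set.Ioc 0 1, (t : ℂ) ^ (u - 1) * (1 - (t : ℂ)) ^ (v - 1) =
      Gamma u * Gamma v / Gamma (u + v) := by
  rw [← betaIntegral_eq_Gamma_mul_div u v hu hv, betaIntegral,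
    intervalIntegral.integral_of_le zero_le_one]

/-- The theorem of Fubini for the Beta integral with respect to a complex order that varies along a
vertical line. -/
lemma integrable_prod_beta_mul {α β : ℂ} {κ γ : ℝ} (hα : κ * γ < α.re) (hβ : 0 < β.re)
    {F : ℂ → ℂ} (hF : VerticalIntegrable F γ) :
    Integrable (fun p : ℝ × ℝ => (p.1 : ℂ) ^ (α - κ * γ - 1) * (1 - (p.1 : ℂ)) ^ (β - 1) *
      F (γ + p.2 * I) * cexp (-(κ * p.2 * Real.log p.1 : ℝ) * I))
      ((volume.restrict (Set.Ioc 0 1)).prod volume) := by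
  have hf : Integrable (fun t : ℝ => (t : ℂ) ^ (α - κ * γ - 1) * (1 - (t : ℂ)) ^ (β - 1))
      (volume.restrict (Set.Ioc 0 1)) := by
    have := betaIntegral_convergent (u := α - κ * γ) (v := β) (by simpa using hα) hβ
    rwa [intervalIntegrable_iff_integrableOn_Ioc_of_le zero_le_one] at this
  -- On the line, t^(α-κs-1) has a part depending on γ but not on y, and a phase exp(-iκy log t).
  -- Only the phase couples t with y, and it has modulus 1.
  refine (hf.mul_prod hF).mul_bdd (c := 1) ?_ (Eventually.of_forall fun p => ?_)
  · refine Measurable.aestronglyMeasurable ?_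
    have := Real.measurable_log
    fun_prop
  · rw [← ofReal_neg, norm_exp_ofReal_mul_I]

lemma cpow_mul_exp_log {α s : ℂ} {κ γ t y : ℝ} (ht : 0 < t) (hs : s = γ + y * I) :
    (t : ℂ) ^ (α - κ * γ - 1) * cexp (-(κ * y * Real.log t : ℝ) * I) =
      (t : ℂ) ^ (α - κ * s - 1) := by
  have ht' : (t : ℂ) ≠ 0 := ofReal_ne_zero.mpr ht.ne'
  rw [cpow_def_of_ne_zero ht', cpow_def_of_ne_zero ht', ← exp_add, ← ofReal_log ht.le, hs]
  push_cast
  ring_nf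

/-- The Riemann–Liouville integral of a Meijer G-function converges absolutely, and it is given by
a Mellin–Barnes integral. -/
theorem rlIntegral_meijerGr_eq_lineIntegral {a₁ a₂ b₁ b₂ : List ℂ} {α β w z : ℂ} {g r γ : ℝ}
    (hw : w ≠ 0) (hz : z ≠ 0) (hβ : 0 < β.re) (hr : r ≠ 0)
    (hleft : ∀ b ∈ b₁, -b.re < γ) (hright : ∀ a ∈ a₁, γ < 1 - a.re)
    (hα : g / r * γ < α.re)
    (hconv : MeijerConvergence a₁ a₂ b₁ b₂ (w * z ^ (g : ℂ)) r γ) :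
    IntervalIntegrable
      (rlIntegrand β (fun τ => τ ^ (α - 1) * meijerGr a₁ a₂ b₁ b₂ (w * τ ^ (g : ℂ)) r) z)
      volume 0 1 ∧
    VerticalIntegrable (fun s => meijerIntegrand a₁ a₂ b₁ b₂ (w * z ^ (g : ℂ)) r s *
      (Gamma (α - (g / r : ℝ) * s) / Gamma (α + β - (g / r : ℝ) * s))) γ ∧
    rlIntegral β (fun τ => τ ^ (α - 1) * meijerGr a₁ a₂ b₁ b₂ (w * τ ^ (g : ℂ)) r) z =
      z ^ (α + β - 1) * lineIntegral (fun s => meijerIntegrand a₁ a₂ b₁ b₂ (w * z ^ (g : ℂ)) r s *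
        (Gamma (α - (g / r : ℝ) * s) / Gamma (α + β - (g / r : ℝ) * s))) γ := by
  set x := w * z ^ (g : ℂ) with hx
  set κ : ℝ := g / r with hκ
  have hx0 : x ≠ 0 := mul_ne_zero hw (by simp [cpow_eq_zero_iff, hz])
  set F := meijerIntegrand a₁ a₂ b₁ b₂ x r with hFdef
  have hF : VerticalIntegrable F γ := (hconv.isMeijerContour hx0 hr hleft hright).integrable
  have hΨ := integrable_prod_beta_mul hα hβ hF
  set Ψ : ℝ × ℝ → ℂ := fun p : ℝ × ℝ => (p.1 : ℂ) ^ (α - κ * γ - 1) * (1 - (p.1 : ℂ)) ^ (β - 1) *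
      F (γ + p.2 * I) * cexp (-(κ * p.2 * Real.log p.1 : ℝ) * I) with hΨdef
  have hG : ∀ t ∈ Set.Ioc (0 : ℝ) 1, rlIntegrand β
      (fun τ => τ ^ (α - 1) * meijerGr a₁ a₂ b₁ b₂ (w * τ ^ (g : ℂ)) r) z t =
      z ^ (α + β - 1) * (1 / (2 * (Real.pi : ℂ))) * ∫ y : ℝ, Ψ (t, y) := by
    intro t ht
    have htg : 0 < t ^ g := Real.rpow_pos_of_pos ht.1 g
    have hne : ((t ^ g : ℝ) : ℂ) * x ≠ 0 := mul_ne_zero (ofReal_ne_zero.mpr htg.ne') hx0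
    have hcont := (hconv.ofReal_mul htg).isMeijerContour hne hr hleft hright
    simp only [rlIntegrand]
    rw [mul_ofReal_mul_cpow hz g ht.1, ← hx, meijerGr_eq_lineIntegral hne hcont, lineIntegral_eq,
      show z - t * z = ((1 - t : ℝ) : ℂ) * z by push_cast; ring,
      ofReal_mul_cpow (by linarith [ht.2]) hz, ofReal_mul_cpow ht.1.le hz]
    have h1 : ∀ y : ℝ, Ψ (t, y) = (1 - (t : ℂ)) ^ (β - 1) * (t : ℂ) ^ (α - 1) *
        meijerIntegrand a₁ a₂ b₁ b₂ (((t ^ g : ℝ) : ℂ) * x) r (γ + y * I) := by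
      intro y
      have h2 : (t : ℂ) ^ (α - κ * (γ + y * I) - 1) =
          (t : ℂ) ^ (α - 1) * (t : ℂ) ^ (-(κ * (γ + y * I))) := by
        rw [← cpow_add _ _ (ofReal_ne_zero.mpr ht.1.ne')]
        ring_nf
      rw [meijerIntegrand_ofReal_mul a₁ a₂ b₁ b₂ hx0 g r ht.1, ← hFdef, ← hκ]
      simp only [hΨdef]
      linear_combination ((1 - (t : ℂ)) ^ (β - 1) * F (γ + y * I)) *
        (cpow_mul_exp_log (α := α) (κ := κ) ht.1 (rfl : (γ : ℂ) + y * I = γ + y * I)) +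
        ((1 - (t : ℂ)) ^ (β - 1) * F (γ + y * I)) * h2
    simp_rw [h1]
    rw [integral_const_mul]
    have h3 : z ^ (α + β - 1) = z ^ (α - 1) * z ^ (β - 1) * z := by
      nth_rw 4 [← cpow_one z]
      rw [← cpow_add _ _ hz, ← cpow_add _ _ hz]
      ring_nf
    rw [h3]
    push_cast
    ring
  have hinner : ∀ y : ℝ, ∫ t in Set.Ioc (0 : ℝ) 1, Ψ (t, y) = Gamma β * (F (γ + y * I) *
      (Gamma (α - κ * (γ + y * I)) / Gamma (α + β - κ * (γ + y * I)))) := by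
    intro y
    set s : ℂ := γ + y * I with hs
    have hre : 0 < (α - κ * s).re := by simpa [hs] using hα
    have h1 : ∫ t in Set.Ioc (0 : ℝ) 1, Ψ (t, y) = ∫ t in Set.Ioc (0 : ℝ) 1,
        F s * ((t : ℂ) ^ (α - κ * s - 1) * (1 - (t : ℂ)) ^ (β - 1)) := by
      refine setIntegral_congr_fun measurableSet_Ioc fun t ht => ?_
      simp only [hΨdef]
      rw [← cpow_mul_exp_log ht.1 hs]
      ring
    rw [h1, integral_const_mul, integral_Ioc_cpow_mul_one_sub_cpow hre hβ,
      show α - κ * s + β = α + β - κ * s by ring]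
    ring
  have hΓ : Gamma β ≠ 0 := Gamma_ne_zero_of_re_pos hβ
  refine ⟨?_, ?_, ?_⟩
  · rw [intervalIntegrable_iff_integrableOn_Ioc_of_le zero_le_one]
    exact (integrableOn_congr_fun hG measurableSet_Ioc).mpr (hΨ.integral_prod_left.const_mul _)
  -- The new integrand is, up to Γ(β), the marginal of an integrable function; no further Stirling
  -- estimate is required.
  · have h1 := hΨ.integral_prod_right.const_mul (Gamma β)⁻¹
    refine h1.congr (Eventually.of_forall fun y => ?_)
    simp only [hinner]
    exact inv_mul_cancel_left₀ hΓ _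
  · rw [rlIntegral, intervalIntegral.integral_of_le zero_le_one,
      setIntegral_congr_fun measurableSet_Ioc hG, integral_const_mul,
      integral_integral_swap (f := fun t y => Ψ (t, y)) hΨ, lineIntegral_eq]
    simp_rw [hinner]
    rw [integral_const_mul, one_div (Gamma β), mul_left_comm _ (Gamma β), inv_mul_cancel_left₀ hΓ,
      mul_assoc]

end RiemannLiouville

/-! ### The extra gamma quotient as Fox parameters. -/

section FoxForm

lemma foxKernel_cons_append (a₁ a₂ b₁ b₂ : List ℂ) (α β : ℂ) (κ : ℝ) (s : ℂ) :
    foxKernel ((1 - α, κ) :: withOne a₁) (withOne a₂) (withOne b₁)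
      (withOne b₂ ++ [(1 - α - β, κ)]) s =
      meijerKernel a₁ a₂ b₁ b₂ s * (Gamma (α - κ * s) / Gamma (α + β - κ * s)) := by
  rw [meijerKernel_eq_foxKernel]
  simp only [foxKernel, List.map_cons, List.prod_cons, List.map_append, List.prod_append,
    List.map_nil, List.prod_nil, mul_one]
  rw [show 1 - (1 - α) - κ * s = α - κ * s by ring,
    show 1 - (1 - α - β) - κ * s = α + β - κ * s by ring]
  simp only [div_eq_mul_inv, mul_inv]
  ring

/-- If the arguments match, then the principal logarithms of `w * z ^ g` and
`w ^ (1 / r) * z ^ (g / r)` differ by the factor `r`. -/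
lemma log_cpow_mul_cpow {w z : ℂ} (hw : w ≠ 0) (hz : z ≠ 0) {g r : ℝ} (hr : r ≠ 0)
    (harg : (w * z ^ (g : ℂ)).arg = r * (w ^ (1 / r : ℂ) * z ^ (g / r : ℂ)).arg) :
    log (w ^ (1 / r : ℂ) * z ^ (g / r : ℂ)) = log (w * z ^ (g : ℂ)) / r := by
  have hr' : (r : ℂ) ≠ 0 := ofReal_ne_zero.mpr hr
  have hw' : 0 < ‖w‖ := norm_pos_iff.mpr hw
  have hz' : 0 < ‖z‖ := norm_pos_iff.mpr hz
  have h1 : Real.log ‖w ^ (1 / r : ℂ) * z ^ (g / r : ℂ)‖ =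
      Real.log ‖w * z ^ (g : ℂ)‖ / r := by
    rw [show (1 / r : ℂ) = ((1 / r : ℝ) : ℂ) by push_cast; rfl,
      show (g / r : ℂ) = ((g / r : ℝ) : ℂ) by push_cast; rfl, norm_mul, norm_mul,
      norm_cpow_real, norm_cpow_real, norm_cpow_real,
      Real.log_mul (Real.rpow_pos_of_pos hw' _).ne' (Real.rpow_pos_of_pos hz' _).ne',
      Real.log_mul hw'.ne' (Real.rpow_pos_of_pos hz' _).ne', Real.log_rpow hw', Real.log_rpow hz',
      Real.log_rpow hz']
    field_simp
  rw [log, log, h1, harg]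
  push_cast
  field_simp

end FoxForm

/-! ### Multiplication formula applied to the parameter lists. -/

section MeijerForm

lemma List.prod_map_range_eq {M : Type*} [CommMonoid M] (n : ℕ) (f : ℕ → M) :
    ((List.range n).map f).prod = ∏ k ∈ Finset.range n, f k := by
  induction n with
  | zero => simp
  | succ n ih => rw [List.range_succ, List.map_append, List.prod_append, ih,
      Finset.prod_range_succ]; simp

/-- In `gaussList` the index j has type ℂ, the range being coerced through the list monad; this form
restores a natural index. -/
lemma gaussList_eq_map_range (k : ℕ) (c : ℂ) :
    gaussList k c = (List.range k).map fun j : ℕ => (c + (j : ℂ)) / k := by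
  have h : (List.range k >>= fun a : ℕ => (pure (a : ℂ) : List ℂ)) =
      (List.range k).map fun a : ℕ => (a : ℂ) :=
    (map_eq_bind_pure_comp _ (fun a : ℕ => (a : ℂ)) (List.range k)).symm
  rw [gaussList]
  refine (congrArg (List.map fun j : ℂ => (c + j) / k) h).trans ?_
  rw [List.map_map]
  rfl

/-- The multiplication formula of Gauss for the factors `Γ(c + s)`. -/
lemma prod_Gamma_gaussList_add {n : ℕ} (hn : n ≠ 0) (b s : ℂ) :
    ((gaussList n b).map fun c => Gamma (c + s)).prod =
      (2 * (Real.pi : ℂ)) ^ (((n : ℂ) - 1) / 2) * (n : ℂ) ^ (1 / 2 - (b + n * s)) *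
        Gamma (b + n * s) := by
  have hn' : (n : ℂ) ≠ 0 := Nat.cast_ne_zero.mpr hn
  rw [gaussList_eq_map_range, List.map_map, List.prod_map_range_eq, ← prod_Gamma_add_div hn]
  refine Finset.prod_congr rfl fun k _ => congrArg Gamma ?_
  field_simp
  ring

/-- The multiplication formula of Gauss for the factors `Γ(1 - c - s)`. -/
lemma prod_Gamma_gaussList_sub {n : ℕ} (hn : n ≠ 0) (a s : ℂ) :
    ((gaussList n a).map fun c => Gamma (1 - c - s)).prod =
      (2 * (Real.pi : ℂ)) ^ (((n : ℂ) - 1) / 2) * (n : ℂ) ^ (1 / 2 - (1 - a - n * s)) *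
        Gamma (1 - a - n * s) := by
  have hn' : (n : ℂ) ≠ 0 := Nat.cast_ne_zero.mpr hn
  -- After the reversal k ↦ n-1-k, the argument 1 - (a+n-1-k)/n - s equals (1-a-ns+k)/n, as Gauss's
  -- formula requires.
  rw [gaussList_eq_map_range, List.map_map, List.prod_map_range_eq, ← prod_Gamma_add_div hn,
    ← Finset.prod_range_reflect]
  refine Finset.prod_congr rfl fun k hk => congrArg Gamma ?_
  have hk' := Finset.mem_range.mp hk
  change 1 - (a + ((n - 1 - k : ℕ) : ℂ)) / n - s = _
  rw [Nat.sub_sub, Nat.cast_sub (by omega)]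
  push_cast
  field_simp
  ring

lemma prod_Gamma_flatMap_gaussList_add {n : ℕ} (hn : n ≠ 0) (l : List ℂ) (s : ℂ) :
    ((l.flatMap (gaussList n)).map fun c => Gamma (c + s)).prod =
      (2 * (Real.pi : ℂ)) ^ (((n : ℂ) - 1) / 2 * l.length) *
        (n : ℂ) ^ (l.length * (1 / 2 - n * s) - l.sum) *
        (l.map fun b => Gamma (b + n * s)).prod := by
  have hn' : (n : ℂ) ≠ 0 := Nat.cast_ne_zero.mpr hn
  have hpi : (2 * (Real.pi : ℂ)) ≠ 0 := by simp [Real.pi_ne_zero]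
  induction l with
  | nil => simp
  | cons b l ih =>
    rw [List.flatMap_cons, List.map_append, List.prod_append, ih, prod_Gamma_gaussList_add hn]
    simp only [List.map_cons, List.prod_cons, List.length_cons, List.sum_cons]
    rw [show ((n : ℂ) - 1) / 2 * ((l.length + 1 : ℕ) : ℂ) =
        ((n : ℂ) - 1) / 2 + ((n : ℂ) - 1) / 2 * l.length by push_cast; ring,
      show ((l.length + 1 : ℕ) : ℂ) * (1 / 2 - n * s) - (b + l.sum) =
        (1 / 2 - (b + n * s)) + (l.length * (1 / 2 - n * s) - l.sum) by push_cast; ring,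
      cpow_add _ _ hpi, cpow_add _ _ hn']
    ring

lemma prod_Gamma_flatMap_gaussList_sub {n : ℕ} (hn : n ≠ 0) (l : List ℂ) (s : ℂ) :
    ((l.flatMap (gaussList n)).map fun c => Gamma (1 - c - s)).prod =
      (2 * (Real.pi : ℂ)) ^ (((n : ℂ) - 1) / 2 * l.length) *
        (n : ℂ) ^ (l.sum - l.length * (1 / 2 - n * s)) *
        (l.map fun a => Gamma (1 - a - n * s)).prod := by
  have hn' : (n : ℂ) ≠ 0 := Nat.cast_ne_zero.mpr hn
  have hpi : (2 * (Real.pi : ℂ)) ≠ 0 := by simp [Real.pi_ne_zero]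
  induction l with
  | nil => simp
  | cons a l ih =>
    rw [List.flatMap_cons, List.map_append, List.prod_append, ih, prod_Gamma_gaussList_sub hn]
    simp only [List.map_cons, List.prod_cons, List.length_cons, List.sum_cons]
    rw [show ((n : ℂ) - 1) / 2 * ((l.length + 1 : ℕ) : ℂ) =
        ((n : ℂ) - 1) / 2 + ((n : ℂ) - 1) / 2 * l.length by push_cast; ring,
      show a + l.sum - ((l.length + 1 : ℕ) : ℂ) * (1 / 2 - n * s) =
        (1 / 2 - (1 - a - n * s)) + (l.sum - l.length * (1 / 2 - n * s)) by push_cast; ring,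
      cpow_add _ _ hpi, cpow_add _ _ hn']
    ring

lemma length_flatMap_gaussList (n : ℕ) (l : List ℂ) :
    (l.flatMap (gaussList n)).length = n * l.length := by
  induction l with
  | nil => simp
  | cons b l ih =>
    rw [List.flatMap_cons, List.length_append, ih, gaussList_eq_map_range, List.length_map, List.length_range,
      List.length_cons]
    ring

lemma forall_mem_flatMap_gaussList {n : ℕ} {l : List ℂ} {p : ℂ → Prop}
    (h : ∀ b ∈ l, ∀ j < n, p ((b + j) / n)) : ∀ c ∈ l.flatMap (gaussList n), p c := by
  intro c hc
  obtain ⟨b, hb, hc⟩ := List.mem_flatMap.mp hc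
  rw [gaussList_eq_map_range] at hc
  obtain ⟨j, hj, rfl⟩ := List.mem_map.mp hc
  exact h b hb j (List.mem_range.mp hj)

/-- Here u is the power of 2π produced by each of the two lists of length g; it occurs above and
below and cancels, so only g^β survives from them. -/
lemma quotient_rearrange {K : Type*} [Field K] {u : K} (hu : u ≠ 0)
    (e₁ e₂ e₃ e₄ f₁ f₂ f₃ f₄ x₁ x₂ x₃ x₄ h₁ h₂ y₁ y₂ : K) :
    (e₁ * f₁ * x₁ * (u * h₁ * y₁ * (e₂ * f₂ * x₂))) /
      (e₃ * f₃ * x₃ * (e₄ * f₄ * x₄ * (u * h₂ * y₂))) =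
    (e₁ * e₂ / (e₃ * e₄)) * (f₁ * f₂ / (f₃ * f₄)) * (h₁ / h₂) *
      ((x₁ * x₂) / (x₃ * x₄) * (y₁ / y₂)) := by
  simp only [div_eq_mul_inv, mul_inv]
  linear_combination (e₁ * e₂ * (e₃⁻¹ * e₄⁻¹) * (f₁ * f₂ * (f₃⁻¹ * f₄⁻¹)) * (h₁ * h₂⁻¹) *
      (x₁ * x₂ * (x₃⁻¹ * x₄⁻¹) * (y₁ * y₂⁻¹))) * mul_inv_cancel₀ hu

/-- The gamma quotient of the Meijer G-function with the parameters of the multiplication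
formula. -/
lemma meijerKernel_gaussList {G R : ℕ} (hG : G ≠ 0) (hR : R ≠ 0) (a₁ a₂ b₁ b₂ : List ℂ)
    (α β s : ℂ) :
    meijerKernel (gaussList G (1 - α) ++ a₁.flatMap (gaussList R)) (a₂.flatMap (gaussList R))
      (b₁.flatMap (gaussList R)) (b₂.flatMap (gaussList R) ++ gaussList G (1 - α - β)) s =
    (2 * (Real.pi : ℂ)) ^ (((R : ℂ) - 1) * ((b₁.length : ℂ) + a₁.length -
        (((a₁ ++ a₂).length : ℂ) + (b₁ ++ b₂).length) / 2)) *
      (R : ℂ) ^ (1 - meijerMu a₁ a₂ b₁ b₂ -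
        (((b₁ ++ b₂).length : ℂ) - (a₁ ++ a₂).length) * (R * s)) * (G : ℂ) ^ β *
      (meijerKernel a₁ a₂ b₁ b₂ (R * s) *
        (Gamma (α - G * s) / Gamma (α + β - G * s))) := by
  have hR' : (R : ℂ) ≠ 0 := Nat.cast_ne_zero.mpr hR
  have hG' : (G : ℂ) ≠ 0 := Nat.cast_ne_zero.mpr hG
  have hpi : (2 * (Real.pi : ℂ)) ≠ 0 := by simp [Real.pi_ne_zero]
  simp only [meijerKernel]
  rw [List.map_append, List.prod_append, List.map_append, List.prod_append,
    prod_Gamma_flatMap_gaussList_add hR, prod_Gamma_flatMap_gaussList_add hR,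
    prod_Gamma_flatMap_gaussList_sub hR, prod_Gamma_flatMap_gaussList_sub hR,
    prod_Gamma_gaussList_sub hG, prod_Gamma_gaussList_sub hG,
    quotient_rearrange (by simp [cpow_eq_zero_iff, hpi]),
    ← cpow_add _ _ hpi, ← cpow_add _ _ hpi, ← cpow_sub _ _ hpi,
    ← cpow_add _ _ hR', ← cpow_add _ _ hR', ← cpow_sub _ _ hR', ← cpow_sub _ _ hG',
    show 1 - (1 - α) - G * s = α - G * s by ring,
    show 1 - (1 - α - β) - G * s = α + β - G * s by ring]
  congr 1
  congr 1
  · congr 1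
    · congr 1
      push_cast [List.length_append]
      ring
    · congr 1
      simp only [meijerMu, List.sum_append]
      push_cast [List.length_append]
      ring
  · congr 1
    ring

lemma div_natCast_zpow_cpow {x : ℂ} (hx : x ≠ 0) {R : ℕ} (hR : R ≠ 0) (k : ℤ) (s : ℂ) :
    (x / (R : ℂ) ^ k) ^ s = x ^ s * (R : ℂ) ^ (-(k * s)) := by
  have hR' : (0 : ℝ) < R := Nat.cast_pos.mpr (Nat.pos_of_ne_zero hR)
  have hρ : (0 : ℝ) < (R : ℝ) ^ (-k) := zpow_pos hR' _
  have hRc : (R : ℂ) ≠ 0 := Nat.cast_ne_zero.mpr hR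
  rw [show x / (R : ℂ) ^ k = (((R : ℝ) ^ (-k) : ℝ) : ℂ) * x by
    push_cast; rw [zpow_neg]; ring, ofReal_mul_cpow hρ.le hx,
    cpow_def_of_ne_zero (ofReal_ne_zero.mpr hρ.ne'), cpow_def_of_ne_zero hRc, ← ofReal_log hρ.le,
    Real.log_zpow, ← natCast_log]
  push_cast
  ring_nf

end MeijerForm

/-! ### The two closed forms. -/

section MainTheorem

lemma foxIntegrand_cons_append_eq (a₁ a₂ b₁ b₂ : List ℂ) (α β : ℂ) {w z : ℂ} (hw : w ≠ 0)
    (hz : z ≠ 0) {g r : ℝ} (hr : r ≠ 0)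
    (harg : (w * z ^ (g : ℂ)).arg = r * (w ^ (1 / r : ℂ) * z ^ (g / r : ℂ)).arg) :
    foxIntegrand ((1 - α, g / r) :: withOne a₁) (withOne a₂) (withOne b₁)
      (withOne b₂ ++ [(1 - α - β, g / r)]) (w ^ (1 / r : ℂ) * z ^ (g / r : ℂ)) =
    fun s => meijerIntegrand a₁ a₂ b₁ b₂ (w * z ^ (g : ℂ)) r s *
      (Gamma (α - (g / r : ℝ) * s) / Gamma (α + β - (g / r : ℝ) * s)) := by
  ext s
  have hx : w * z ^ (g : ℂ) ≠ 0 := mul_ne_zero hw (by simp [cpow_eq_zero_iff, hz])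
  have hX : w ^ (1 / r : ℂ) * z ^ (g / r : ℂ) ≠ 0 :=
    mul_ne_zero (by simp [cpow_eq_zero_iff, hw]) (by simp [cpow_eq_zero_iff, hz])
  have hpow : (w ^ (1 / r : ℂ) * z ^ (g / r : ℂ)) ^ (-s) = (w * z ^ (g : ℂ)) ^ (-s / (r : ℂ)) := by
    rw [cpow_def_of_ne_zero hX, cpow_def_of_ne_zero hx, log_cpow_mul_cpow hw hz hr harg]
    ring_nf
  rw [foxIntegrand, foxKernel_cons_append, meijerIntegrand, hpow]
  ring

lemma meijerIntegrand_gaussList {G R : ℕ} (hG : G ≠ 0) (hR : R ≠ 0) (a₁ a₂ b₁ b₂ : List ℂ)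
    (α β : ℂ) {x : ℂ} (hx : x ≠ 0) (s : ℂ) :
    meijerIntegrand (gaussList G (1 - α) ++ a₁.flatMap (gaussList R)) (a₂.flatMap (gaussList R))
      (b₁.flatMap (gaussList R)) (b₂.flatMap (gaussList R) ++ gaussList G (1 - α - β))
      (x / (R : ℂ) ^ ((R : ℤ) * (((b₁ ++ b₂).length : ℤ) - ((a₁ ++ a₂).length : ℤ)))) 1 s =
    (2 * (Real.pi : ℂ)) ^ (((R : ℂ) - 1) * ((b₁.length : ℂ) + a₁.length -
        (((a₁ ++ a₂).length : ℂ) + (b₁ ++ b₂).length) / 2)) *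
      (R : ℂ) ^ (1 - meijerMu a₁ a₂ b₁ b₂) * (G : ℂ) ^ β *
      (meijerIntegrand a₁ a₂ b₁ b₂ x R (R * s) *
        (Gamma (α - ((G : ℝ) / (R : ℝ) : ℝ) * (R * s)) /
          Gamma (α + β - ((G : ℝ) / (R : ℝ) : ℝ) * (R * s)))) := by
  have hR' : (R : ℂ) ≠ 0 := Nat.cast_ne_zero.mpr hR
  have hκ : ((G : ℝ) / (R : ℝ) : ℝ) * ((R : ℂ) * s) = G * s := by
    push_cast
    field_simp
  have hpow : x ^ (-(R * s) / ((R : ℝ) : ℂ)) = x ^ (-s) := by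
    congr 1
    push_cast
    field_simp
  rw [meijerIntegrand, meijerIntegrand, meijerKernel_gaussList hG hR,
    ofReal_one, div_one, div_natCast_zpow_cpow hx hR, hκ, hpow]
  -- The s-dependent power of r left by Gauss's formula is cancelled by the divisor r^(r(q-p)) in
  -- the argument of the G-function.
  have hcomb : (R : ℂ) ^ (1 - meijerMu a₁ a₂ b₁ b₂ -
      (((b₁ ++ b₂).length : ℂ) - (a₁ ++ a₂).length) * (R * s)) *
      (R : ℂ) ^ (-((((R : ℤ) * (((b₁ ++ b₂).length : ℤ) - ((a₁ ++ a₂).length : ℤ)) : ℤ) : ℂ) *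
        -s)) = (R : ℂ) ^ (1 - meijerMu a₁ a₂ b₁ b₂) := by
    rw [← cpow_add _ _ hR']
    congr 1
    push_cast
    ring
  rw [← hcomb]
  ring

/-- The Meijer G-function with the parameters of the multiplication formula of Gauss. -/
lemma meijerG_gaussList {G R : ℕ} (hG : G ≠ 0) (hR : R ≠ 0) {a₁ a₂ b₁ b₂ : List ℂ} {α : ℂ} (β : ℂ)
    {x : ℂ} (hx : x ≠ 0) {γ : ℝ}
    (hleft : ∀ b ∈ b₁, -b.re < γ) (hright : ∀ a ∈ a₁, γ < 1 - a.re)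
    (hα : (G : ℝ) / R * γ < α.re)
    (hint : VerticalIntegrable (fun s => meijerIntegrand a₁ a₂ b₁ b₂ x R s *
        (Gamma (α - ((G : ℝ) / (R : ℝ) : ℝ) * s) /
          Gamma (α + β - ((G : ℝ) / (R : ℝ) : ℝ) * s))) γ) :
    IsMeijerContour (gaussList G (1 - α) ++ a₁.flatMap (gaussList R)) (a₂.flatMap (gaussList R))
      (b₁.flatMap (gaussList R)) (b₂.flatMap (gaussList R) ++ gaussList G (1 - α - β))
      (x / (R : ℂ) ^ ((R : ℤ) * (((b₁ ++ b₂).length : ℤ) - ((a₁ ++ a₂).length : ℤ)))) 1 (γ / R) ∧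
    meijerG (gaussList G (1 - α) ++ a₁.flatMap (gaussList R)) (a₂.flatMap (gaussList R))
      (b₁.flatMap (gaussList R)) (b₂.flatMap (gaussList R) ++ gaussList G (1 - α - β))
      (x / (R : ℂ) ^ ((R : ℤ) * (((b₁ ++ b₂).length : ℤ) - ((a₁ ++ a₂).length : ℤ)))) =
    (2 * (Real.pi : ℂ)) ^ (((R : ℂ) - 1) * ((b₁.length : ℂ) + a₁.length -
        (((a₁ ++ a₂).length : ℂ) + (b₁ ++ b₂).length) / 2)) *
      (R : ℂ) ^ (-meijerMu a₁ a₂ b₁ b₂) * (G : ℂ) ^ β *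
      lineIntegral (fun s => meijerIntegrand a₁ a₂ b₁ b₂ x R s *
        (Gamma (α - ((G : ℝ) / (R : ℝ) : ℝ) * s) /
          Gamma (α + β - ((G : ℝ) / (R : ℝ) : ℝ) * s))) γ := by
  have hR' : (R : ℂ) ≠ 0 := Nat.cast_ne_zero.mpr hR
  have hRpos : (0 : ℝ) < R := Nat.cast_pos.mpr (Nat.pos_of_ne_zero hR)
  have hGpos : (0 : ℝ) < G := Nat.cast_pos.mpr (Nat.pos_of_ne_zero hG)
  set H : ℂ → ℂ := fun s => meijerIntegrand a₁ a₂ b₁ b₂ x R s *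
        (Gamma (α - ((G : ℝ) / (R : ℝ) : ℝ) * s) /
          Gamma (α + β - ((G : ℝ) / (R : ℝ) : ℝ) * s)) with hH
  have hne : x / (R : ℂ) ^ ((R : ℤ) * (((b₁ ++ b₂).length : ℤ) - ((a₁ ++ a₂).length : ℤ))) ≠ 0 :=
    div_ne_zero hx (zpow_ne_zero _ hR')
  have hre : ∀ (n : ℕ) (c : ℂ) (j : ℕ), ((c + j) / n).re = (c.re + j) / n := by
    intro n c j
    rw [div_natCast_re, add_re, natCast_re]
  have hline : ∀ y : ℝ, (R : ℂ) * (((γ / R : ℝ) : ℂ) + y * I) = γ + ((R * y : ℝ) : ℂ) * I := by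
    intro y
    push_cast
    field_simp
  have hcontour : IsMeijerContour (gaussList G (1 - α) ++ a₁.flatMap (gaussList R))
      (a₂.flatMap (gaussList R)) (b₁.flatMap (gaussList R))
      (b₂.flatMap (gaussList R) ++ gaussList G (1 - α - β))
      (x / (R : ℂ) ^ ((R : ℤ) * (((b₁ ++ b₂).length : ℤ) - ((a₁ ++ a₂).length : ℤ)))) 1
      (γ / R) := by
    refine ⟨forall_mem_flatMap_gaussList fun b hb j _ => ?_, fun c hc => ?_, ?_⟩
    · have := hleft b hb
      rw [hre, ← add_div]
      have hj : (0 : ℝ) ≤ j := Nat.cast_nonneg j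
      exact div_pos (by linarith) hRpos
    · rcases List.mem_append.mp hc with hc | hc
      · rw [gaussList_eq_map_range] at hc
        obtain ⟨j, hj, rfl⟩ := List.mem_map.mp hc
        have hj' : (j : ℝ) + 1 ≤ G := by exact_mod_cast List.mem_range.mp hj
        -- Since j ≤ g - 1, the numerator is at least Re α - (g/r)γ, which is positive.
        rw [hre, show 1 - ((1 - α).re + j) / G - γ / R =
          (G - (1 - α).re - j - G / R * γ) / G by field_simp; ring]
        refine div_pos ?_ hGpos
        simp only [sub_re, one_re]
        linarith
      · refine forall_mem_flatMap_gaussList (p := fun c => 0 < 1 - c.re - γ / R)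
          (fun a ha j hj => ?_) c hc
        have := hright a ha
        have hj' : (j : ℝ) + 1 ≤ R := by exact_mod_cast hj
        rw [hre, show 1 - (a.re + j) / R - γ / R = (R - a.re - j - γ) / R by
          field_simp; ring]
        exact div_pos (by linarith) hRpos
    · unfold VerticalIntegrable
      simp_rw [meijerIntegrand_gaussList hG hR a₁ a₂ b₁ b₂ α β hx, hline]
      exact (hint.comp_mul_left' hRpos.ne').const_mul _
  refine ⟨hcontour, ?_⟩
  rw [meijerG, meijerGr_eq_lineIntegral hne hcontour, lineIntegral_eq, lineIntegral_eq]
  simp_rw [meijerIntegrand_gaussList hG hR a₁ a₂ b₁ b₂ α β hx, hline]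
  -- The substitution y ↦ ry contributes 1/r and turns r^(1-μ) into r^(-μ).
  rw [integral_const_mul, Measure.integral_comp_mul_left (fun y : ℝ => H (γ + y * I)),
    abs_of_pos (inv_pos.mpr hRpos), real_smul, sub_eq_add_neg 1 (meijerMu a₁ a₂ b₁ b₂),
    cpow_add _ _ hR', cpow_one]
  generalize (∫ y : ℝ, H (γ + y * I)) = J
  push_cast
  field_simp

end MainTheorem

theorem mainTheorem2
    (a₁ a₂ b₁ b₂ : List ℂ) (α β w z : ℂ) (g r γ : ℝ)
    (hw : w ≠ 0) (hz : z ≠ 0) (hβ : 0 < β.re) (hr : r ≠ 0) (hgr : 0 < g / r)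
    (hleft : ∀ b ∈ b₁, -b.re < γ) (hright : ∀ a ∈ a₁, γ < 1 - a.re)
    (hα : g / r * γ < α.re)
    (hconv : MeijerConvergence a₁ a₂ b₁ b₂ (w * z ^ (g : ℂ)) r γ) :
    -- the G-function is defined along the segment, and the Riemann–Liouville integral converges
    (∀ t ∈ Set.Ioc (0 : ℝ) 1,
      ∃ γ' : ℝ, IsMeijerContour a₁ a₂ b₁ b₂ (w * (t * z) ^ (g : ℂ)) r γ') ∧
    IntervalIntegrable
      (rlIntegrand β (fun τ => τ ^ (α - 1) * meijerGr a₁ a₂ b₁ b₂ (w * τ ^ (g : ℂ)) r) z)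
      MeasureTheory.volume 0 1 ∧
    -- the Fox H form
    ((w * z ^ (g : ℂ)).arg = r * (w ^ (1 / r : ℂ) * z ^ (g / r : ℂ)).arg →
      (∃ γ' : ℝ, IsFoxContour ((1 - α, g / r) :: withOne a₁) (withOne a₂)
        (withOne b₁) (withOne b₂ ++ [(1 - α - β, g / r)])
        (w ^ (1 / r : ℂ) * z ^ (g / r : ℂ)) γ') ∧
      rlIntegral β (fun τ => τ ^ (α - 1) * meijerGr a₁ a₂ b₁ b₂ (w * τ ^ (g : ℂ)) r) z =
        z ^ (α + β - 1) *
          foxH ((1 - α, g / r) :: withOne a₁) (withOne a₂)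
            (withOne b₁) (withOne b₂ ++ [(1 - α - β, g / r)])
            (w ^ (1 / r : ℂ) * z ^ (g / r : ℂ))) ∧
    -- the Meijer G form for positive integers `g = G` and `r = R`
    (∀ G R : ℕ, g = G → r = R →
      ∀ p q : ℕ, p = (a₁ ++ a₂).length → q = (b₁ ++ b₂).length →
      ∀ Δ₁ Δ₂ Δ₃ Δ₄ : List ℂ,
      Δ₁ = gaussList G (1 - α) ++ a₁.flatMap (gaussList R) →
      Δ₂ = a₂.flatMap (gaussList R) →
      Δ₃ = b₁.flatMap (gaussList R) →
      Δ₄ = b₂.flatMap (gaussList R) ++ gaussList G (1 - α - β) →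
      (Δ₃.length = R * b₁.length ∧ Δ₁.length = R * a₁.length + G ∧
        (Δ₁ ++ Δ₂).length = R * p + G ∧ (Δ₃ ++ Δ₄).length = R * q + G) ∧
      (∃ γ' : ℝ, IsMeijerContour Δ₁ Δ₂ Δ₃ Δ₄
        (w * z ^ G / (R : ℂ) ^ ((R : ℤ) * ((q : ℤ) - (p : ℤ)))) 1 γ') ∧
      rlIntegral β (fun τ => τ ^ (α - 1) * meijerGr a₁ a₂ b₁ b₂ (w * τ ^ G) R) z =
        z ^ (α + β - 1) *
          ((R : ℂ) ^ ((b₁ ++ b₂).sum - (a₁ ++ a₂).sum + ((p : ℂ) - q) / 2 + 1) /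
            ((2 * (Real.pi : ℂ)) ^
                (((R : ℂ) - 1) * ((b₁.length : ℂ) + a₁.length - ((p : ℂ) + q) / 2)) *
              (G : ℂ) ^ β)) *
          meijerG Δ₁ Δ₂ Δ₃ Δ₄ (w * z ^ G / (R : ℂ) ^ ((R : ℤ) * ((q : ℤ) - (p : ℤ))))) := by

  have hx : w * z ^ (g : ℂ) ≠ 0 := mul_ne_zero hw (by simp [cpow_eq_zero_iff, hz])
  obtain ⟨hI, hV, hE⟩ :=
    rlIntegral_meijerGr_eq_lineIntegral hw hz hβ hr hleft hright hα hconv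
  refine ⟨fun t ht => ⟨γ, ?_⟩, hI, fun harg => ?_, ?_⟩
  · have htg : 0 < t ^ g := Real.rpow_pos_of_pos ht.1 g
    rw [mul_ofReal_mul_cpow hz g ht.1]
    exact (hconv.ofReal_mul htg).isMeijerContour (mul_ne_zero (ofReal_ne_zero.mpr htg.ne') hx) hr
      hleft hright
  · have hX : w ^ (1 / r : ℂ) * z ^ (g / r : ℂ) ≠ 0 :=
      mul_ne_zero (by simp [cpow_eq_zero_iff, hw]) (by simp [cpow_eq_zero_iff, hz])
    have hF := foxIntegrand_cons_append_eq a₁ a₂ b₁ b₂ α β hw hz hr harg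
    have hcontour : IsFoxContour ((1 - α, g / r) :: withOne a₁) (withOne a₂)
        (withOne b₁) (withOne b₂ ++ [(1 - α - β, g / r)])
        (w ^ (1 / r : ℂ) * z ^ (g / r : ℂ)) γ := by
      refine ⟨?_, forall_mem_withOne fun b hb => ?_, ?_, by rwa [hF]⟩
      · have hone : ∀ l : List ℂ, ∀ c ∈ withOne l, 0 < c.2 := fun l =>
          forall_mem_withOne fun c _ => one_pos
        intro c hc
        simp only [List.mem_append, List.mem_cons, List.not_mem_nil, or_false] at hc
        rcases hc with (((rfl | hc) | hc) | hc) | (hc | rfl)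
        · exact hgr
        · exact hone _ c hc
        · exact hone _ c hc
        · exact hone _ c hc
        · exact hone _ c hc
        · exact hgr
      · have := hleft b hb
        simp only
        linarith
      · intro a ha
        rcases List.mem_cons.mp ha with rfl | ha
        · simp only [sub_re, one_re]
          linarith
        · refine forall_mem_withOne (p := fun a => 0 < 1 - a.1.re - a.2 * γ) (fun a ha => ?_) a ha
          have := hright a ha
          simp only
          linarith
    refine ⟨⟨γ, hcontour⟩, ?_⟩
    rw [hE, foxH_eq_lineIntegral hX hcontour, hF]
  · rintro G R rfl rfl p q rfl rfl Δ₁ Δ₂ Δ₃ Δ₄ rfl rfl rfl rfl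
    have hR : R ≠ 0 := fun h => hr (by simp [h])
    have hG : G ≠ 0 := fun h => by simp [h] at hgr
    have hR' : (R : ℂ) ≠ 0 := Nat.cast_ne_zero.mpr hR
    have hG' : (G : ℂ) ≠ 0 := Nat.cast_ne_zero.mpr hG
    have hlen : ∀ c : ℂ, (gaussList G c).length = G := fun c => by
      rw [gaussList_eq_map_range, List.length_map, List.length_range]
    simp only [ofReal_natCast, cpow_natCast] at hx hV hE
    obtain ⟨hcontour, hval⟩ := meijerG_gaussList hG hR β hx hleft hright hα hV
    refine ⟨⟨length_flatMap_gaussList R b₁, ?_, ?_, ?_⟩, ⟨γ / R, hcontour⟩, ?_⟩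
    · rw [List.length_append, hlen, length_flatMap_gaussList, add_comm]
    · simp only [List.length_append, hlen, length_flatMap_gaussList]
      ring
    · simp only [List.length_append, hlen, length_flatMap_gaussList]
      ring
    · rw [hE, hval, ← meijerMu, cpow_neg]
      have h1 : (2 * (Real.pi : ℂ)) ^ (((R : ℂ) - 1) * ((b₁.length : ℂ) + a₁.length -
          (((a₁ ++ a₂).length : ℂ) + (b₁ ++ b₂).length) / 2)) ≠ 0 := by
        simp [cpow_eq_zero_iff, Real.pi_ne_zero]
      have h2 : (R : ℂ) ^ meijerMu a₁ a₂ b₁ b₂ ≠ 0 := by simp [cpow_eq_zero_iff, hR']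
      have h3 : (G : ℂ) ^ β ≠ 0 := by simp [cpow_eq_zero_iff, hG']
      generalize lineIntegral _ γ = J
      field_simp
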